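/- For an infinite cardinal $\mu$ and a cardinal $\kappa>0$, equip the set ${}^{\mu}\kappa$ of all functions from $\mu$ to $\kappa$ with the topology whose basic open sets are the sets $\{f\in{}^{\mu}\kappa : s\subseteq f\}$ with $s:\xi\to\kappa$ and $\xi<\mu$. For an infinite cardinal $\nu$, equip the power set $\mathcal{P}(\nu)$ with the topology whose basic open sets are the sets $\{y\subseteq\nu : y\cap\eta=a\}$ with $\eta<\nu$ and $a\subseteq\eta$. An injection $\iota:{}^{\mu}\kappa\to\mathcal{P}(\nu)$ is a perfect embedding if it is a homeomorphism between ${}^{\mu}\kappa$ and the subspace $\mathrm{ran}(\iota)$ of $\mathcal{P}(\nu)$. A measurable cardinal is an uncountable cardinal $\delta$ that carries a $\delta$-complete nonprincipal ultrafilter, and $H(\kappa)$ is the collection of all sets whose transitive closure has cardinality less than $\kappa$. A $\Sigma_1$-formula is a formula of the language of set theory that consists of a finite block of existential quantifiers followed by a formula all of whose quantifiers are bounded. Theorem. Let $\kappa$ be a limit of measurable cardinals (that is, $\kappa>0$ and the measurable cardinals smaller than $\kappa$ are unbounded in $\kappa$), and let $D\subseteq\mathcal{P}(\kappa)$ be definable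 by a $\Sigma_1$-formula with parameters in $H(\kappa)\cup\{\kappa\}$, i.e. there are a $\Sigma_1$-formula $\varphi(v_0,\dots,v_n)$ and $p_1,\dots,p_n\in H(\kappa)\cup\{\kappa\}$ with $D=\{y : \varphi(y,p_1,\dots,p_n)\}$. If $|D|>\kappa$, then there is a perfect embedding $\iota:{}^{\mathrm{cof}(\kappa)}\kappa\to\mathcal{P}(\kappa)$ with $\mathrm{ran}(\iota)\subseteq D$. -/

import Mathlib

open Set Cardinal

universe u

namespace PerfectSubset

/-! ### The language of set theory and the Lévy hierarchy at its lowest levels -/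

/-- The only relation symbol of the language of set theory: a binary one. -/
inductive MemRel : ℕ → Type
  | mem : MemRel 2

/-- The first-order language of set theory. -/
def langSet : FirstOrder.Language := ⟨fun _ => Empty, MemRel⟩

/-- The membership symbol. -/
def memSymb : langSet.Relations 2 := MemRel.mem

/-- The universe of sets as a structure, the relation symbol being interpreted by membership. -/
instance structureZFSet : langSet.Structure ZFSet.{u} where
  funMap := fun f => f.elim
  RelMap := fun {_} r => match r with
    | MemRel.mem => fun v => v 0 ∈ v 1

open FirstOrder Language BoundedFormula

/-- The atomic formula `t ∈ s`. -/
def memFormula {α : Type} {n : ℕ} (t s : langSet.Term (α ⊕ Fin n)) :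
    langSet.BoundedFormula α n :=
  memSymb.boundedFormula₂ t s

/-- The variable `v` of a formula with `n` de Bruijn variables, below one more quantifier. -/
def liftVar {α : Type} {n : ℕ} (v : α ⊕ Fin n) : langSet.Term (α ⊕ Fin (n + 1)) :=
  Term.var (Sum.map id Fin.castSucc v)

/-- The variable bound by the innermost of `n + 1` quantifiers. -/
def lastVar {α : Type} {n : ℕ} : langSet.Term (α ⊕ Fin (n + 1)) :=
  Term.var (Sum.inr (Fin.last n))

/-- The `Δ₀` formulas: all quantifiers are bounded, that is, of the form `∀ x ∈ v` or `∃ x ∈ v`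
with a variable `v` different from `x`. Negation, conjunction and disjunction are
abbreviations in terms of `⊥` and implication. -/
inductive IsDelta0 {α : Type} : ∀ {n : ℕ}, langSet.BoundedFormula α n → Prop
  | falsum {n : ℕ} : IsDelta0 (BoundedFormula.falsum : langSet.BoundedFormula α n)
  | equal {n : ℕ} (t s : langSet.Term (α ⊕ Fin n)) : IsDelta0 (BoundedFormula.equal t s)
  | mem {n : ℕ} (t s : langSet.Term (α ⊕ Fin n)) : IsDelta0 (memFormula t s)
  | imp {n : ℕ} {φ ψ : langSet.BoundedFormula α n} :
      IsDelta0 φ → IsDelta0 ψ → IsDelta0 (φ.imp ψ)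
  | ball {n : ℕ} (v : α ⊕ Fin n) {φ : langSet.BoundedFormula α (n + 1)} :
      IsDelta0 φ → IsDelta0 (BoundedFormula.all ((memFormula lastVar (liftVar v)).imp φ))
  | bex {n : ℕ} (v : α ⊕ Fin n) {φ : langSet.BoundedFormula α (n + 1)} :
      IsDelta0 φ → IsDelta0 (BoundedFormula.ex (memFormula lastVar (liftVar v) ⊓ φ))

/-- The `Σ₁` formulas: a finite block of existential quantifiers before a `Δ₀` formula. -/
inductive IsSigma1 {α : Type} : ∀ {n : ℕ}, langSet.BoundedFormula α n → Prop
  | of_delta0 {n : ℕ} {φ : langSet.BoundedFormula α n} : IsDelta0 φ → IsSigma1 φ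
  | ex {n : ℕ} {φ : langSet.BoundedFormula α (n + 1)} :
      IsSigma1 φ → IsSigma1 (BoundedFormula.ex φ)

/-- `D` is definable (in the universe of sets) by a `Σ₁` formula with parameters in `P`. -/
def Sigma1DefinableWith (P : Set ZFSet.{u}) (D : ZFSet.{u}) : Prop :=
  ∃ (n : ℕ) (φ : langSet.Formula (Fin (n + 1))) (p : Fin n → ZFSet.{u}),
    IsSigma1 φ ∧ (∀ i, p i ∈ P) ∧
      ∀ y : ZFSet.{u}, y ∈ D ↔ φ.Realize (Fin.cons y p : Fin (n + 1) → ZFSet.{u})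

/-! ### Cardinals and hereditarily small sets -/

/-- The elements of the transitive closure of `x`. -/
def transClosure (x : ZFSet.{u}) : Set ZFSet.{u} :=
  {y | Relation.TransGen (· ∈ ·) y x}

/-- `H(κ)`: the sets whose transitive closure has cardinality less than `κ`. -/
def H (κ : Cardinal.{u}) : Set ZFSet.{u} :=
  {x | #(transClosure x) < lift.{u + 1} κ}

/-- `δ` is a measurable cardinal: it is uncountable and there is a `δ`-complete nonprincipal
ultrafilter on (a set of size) `δ`. -/
def IsMeasurableCardinal (δ : Cardinal.{u}) : Prop :=
  ℵ₀ < δ ∧ ∃ U : Ultrafilter δ.ord.ToType,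
    CardinalInterFilter (U : Filter δ.ord.ToType) δ ∧ ∀ a, {a} ∉ U

/-- `κ` is a limit of measurable cardinals. -/
def IsLimitOfMeasurables (κ : Cardinal.{u}) : Prop :=
  κ ≠ 0 ∧ ∀ ν < κ, ∃ δ, ν < δ ∧ δ < κ ∧ IsMeasurableCardinal δ

/-! ### Function spaces and power sets -/

/-- The set of all functions from the ordinal `μ` to the ordinal `κ`. -/
def FunSpace (μ κ : Ordinal.{u}) : Type (u + 1) :=
  Iio μ → Iio κ

/-- The set of all functions from `μ` to `κ` that extend `s : ξ → κ`. -/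
def FunSpace.cone {μ κ ξ : Ordinal.{u}} (hξ : ξ < μ) (s : Iio ξ → Iio κ) :
    Set (FunSpace μ κ) :=
  {f | ∀ i : Iio ξ, f ⟨i.1, lt_trans i.2 hξ⟩ = s i}

/-- The topology whose basic open sets consist of all extensions of a function `s : ξ → κ`
with `ξ < μ`. -/
instance FunSpace.topology (μ κ : Ordinal.{u}) : TopologicalSpace (FunSpace μ κ) :=
  TopologicalSpace.generateFrom
    {U | ∃ (ξ : Ordinal.{u}) (hξ : ξ < μ) (s : Iio ξ → Iio κ), U = FunSpace.cone hξ s}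

/-- The power set of the (von Neumann) ordinal `ν`. -/
def PowSpace (ν : Ordinal.{u}) : Type (u + 1) :=
  {y : ZFSet.{u} // y ⊆ ν.toZFSet}

/-- The topology whose basic open sets consist of all subsets of `ν` whose intersection with
a given ordinal `η < ν` is a given subset of `η`. -/
instance PowSpace.topology (ν : Ordinal.{u}) : TopologicalSpace (PowSpace ν) :=
  TopologicalSpace.generateFrom
    {U | ∃ η < ν, ∃ a ⊆ η.toZFSet, U = {y : PowSpace ν | y.1 ∩ η.toZFSet = a}}

/-- A perfect embedding: an injection that is a homeomorphism onto its range. -/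
def IsPerfectEmbedding {μ κ ν : Ordinal.{u}} (ι : FunSpace μ κ → PowSpace ν) : Prop :=
  Topology.IsEmbedding ι

end PerfectSubset

/-! Iterated ultrapowers carry one element of `D` to many others without leaving `D`. Let j be the
embedding of the universe into the transitive collapse of an iterated ultrapower by countably
complete ultrafilters. By Łoś's theorem for Δ₀ formulas (`realize_collapse_iff`), a Σ₁ statement
about y and p yields the same statement about j(y) and j(p), true in the universe itself
(`realize_emb_of_sigma1`). So if j fixes κ and the parameters, then y ∈ D gives j(y) ∈ D. It remains
to find y ∈ D and embeddings j_f, for f : cof(κ) → κ, such that f ↦ j_f(y) is a perfect embedding.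

Choice of y. Fix κ many measurable cardinals below κ. If no iteration of the measure on δ of length
(2^ν)⁺ < κ with ν ≥ δ moves y below κ, then y is determined by y ∩ δ, because long iterations send δ
above any given θ < κ (`Label.eq_of_fixed`). As κ is a strong limit, only κ many sets arise in this
way. Since |D| > κ, some y ∈ D is moved by all the chosen measures (`exists_moves`).

Separation. Write i_ν for the iteration of one measure of length (2^ν)⁺. For 2^ν < 2^ν', lengths add
to the longer one, so i_ν(i_ν'(y)) = i_ν'(y) (`Label.block_block`). With injectivity of i_ν, once y
is moved, iterations of sufficiently different lengths give different images
(`Label.exists_lengths`).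

Assembly. Take a cofinal sequence of cof(κ) many measures, widely spaced, and use the ξ-th one for a
length that codes f restricted to ξ, truncated so that fewer than κ codes are needed (`Tower`).
Stages with more complete ultrafilters do not affect what happens below their completeness, so an
initial part of j_f(y) depends only on an initial part of f (`Tower.mem_image_congr`). Conversely,
at the first place where the codes of f and g differ, the images of y differ below a bound that
later stages leave alone (`Tower.min_eq_min_of_image`). All measures lie above the sizes of the
parameters in H(κ), and κ is a fixed point (`Tower.emb_eq_self`, `Tower.oemb_ord`). -/

namespace IteratedUltrapower

open Filter

/-! ### Functions of finite support on a product -/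

section FinSupp

variable {L X : Type u} {A B C : Type*}

/-- A function on `L → X` that depends on finitely many coordinates only. -/
def FinSupp (F : (L → X) → A) : Prop := ∃ s : Finset L, DependsOn F (s : Set L)

theorem FinSupp.const (a : A) : FinSupp (fun _ : L → X => a) := ⟨∅, fun _ _ _ => rfl⟩

theorem FinSupp.coord (i : L) : FinSupp (fun x : L → X => x i) :=
  ⟨{i}, fun _ _ h => h i (by simp)⟩

theorem FinSupp.comp {F : (L → X) → A} (hF : FinSupp F) (g : A → B) :
    FinSupp (fun x => g (F x)) := by
  obtain ⟨s, hs⟩ := hF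
  exact ⟨s, fun x y h => congrArg g (hs h)⟩

theorem FinSupp.pair {F : (L → X) → A} {G : (L → X) → B} (hF : FinSupp F) (hG : FinSupp G) :
    FinSupp (fun x => (F x, G x)) := by
  classical
  obtain ⟨s, hs⟩ := hF
  obtain ⟨t, ht⟩ := hG
  exact ⟨s ∪ t, fun x y h => Prod.ext (hs fun i hi => h i (by simp_all))
    (ht fun i hi => h i (by simp_all))⟩

theorem FinSupp.comp₂ {F : (L → X) → A} {G : (L → X) → B} (hF : FinSupp F) (hG : FinSupp G)
    (g : A → B → C) : FinSupp (fun x => g (F x) (G x)) :=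
  (hF.pair hG).comp fun p => g p.1 p.2

theorem FinSupp.pi {ι : Type*} [Finite ι] {A : ι → Type*} {F : ∀ k, (L → X) → A k}
    (hF : ∀ k, FinSupp (F k)) : FinSupp (fun x k => F k x) := by
  classical
  choose s hs using hF
  have := Fintype.ofFinite ι
  refine ⟨Finset.univ.biUnion s, fun x y h => funext fun k => hs k fun i hi => h i ?_⟩
  simp only [Finset.coe_biUnion, Set.mem_iUnion]
  exact ⟨k, by simp, hi⟩

theorem FinSupp.pull {L' : Type u} {F : (L → X) → A} (hF : FinSupp F) (e : L → L') :
    FinSupp (fun x : L' → X => F (x ∘ e)) := by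
  classical
  obtain ⟨s, hs⟩ := hF
  refine ⟨s.image e, fun x y h => hs fun i hi => h _ ?_⟩
  simp only [Finset.coe_image]
  exact mem_image_of_mem e hi

end FinSupp

/-- The countably complete ultrafilters on `X`. -/
abbrev CUltrafilter (X : Type u) : Type u :=
  {U : Ultrafilter X // CountableInterFilter (U : Filter X)}

/-! ### The filter of the finite support iteration -/

section Filter

variable {L X : Type u} [LinearOrder L] (U : L → CUltrafilter X)

/-- A strategy assigns to every stage `i` and every play before `i` a set that is large for the
ultrafilter of that stage. -/
structure Strategy where
  toFun : L → (L → X) → Set X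
  mem : ∀ i x, toFun i x ∈ (U i).1
  local_eq : ∀ i x y, (∀ k < i, x k = y k) → toFun i x = toFun i y

variable {U}

/-- The plays that follow a strategy. -/
def Strategy.runs (S : Strategy U) : Set (L → X) := {x | ∀ i, x i ∈ S.toFun i x}

theorem Strategy.runs_nonempty [WellFoundedLT L] [Nonempty X] (S : Strategy U) :
    S.runs.Nonempty := by
  classical
  have hne : ∀ i x, (S.toFun i x).Nonempty := fun i x => (U i).1.nonempty_of_mem (S.mem i x)
  let a : X := Classical.arbitrary X
  let step : ∀ i : L, (∀ k, k < i → X) → X := fun i f =>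
    (hne i (fun k => if h : k < i then f k h else a)).some
  let x : L → X := (wellFounded_lt (α := L)).fix step
  refine ⟨x, fun i => ?_⟩
  have hx : x i = step i (fun k _ => x k) := WellFounded.fix_eq _ _ _
  rw [hx]
  have h1 := (hne i (fun k => if h : k < i then x k else a)).some_mem
  -- The choice at stage `i` was made with the unknown later coordinates set to `a`; by locality the
  -- strategy does not see them.
  rw [S.local_eq i x (fun k => if h : k < i then x k else a) fun k hk => by simp [hk]]
  exact h1

variable (U)

/-- The filter on `L → X` generated by the strategies. -/
def iterFilter : Filter (L → X) where
  sets := {P | ∃ S : Strategy U, S.runs ⊆ P}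
  univ_sets := ⟨⟨fun _ _ => univ, fun _ _ => univ_mem, fun _ _ _ _ => rfl⟩, subset_univ _⟩
  sets_of_superset := fun ⟨S, hS⟩ h => ⟨S, hS.trans h⟩
  inter_sets := by
    rintro P Q ⟨S, hS⟩ ⟨T, hT⟩
    refine ⟨⟨fun i x => S.toFun i x ∩ T.toFun i x, fun i x => inter_mem (S.mem i x) (T.mem i x),
      fun i x y h => by rw [S.local_eq i x y h, T.local_eq i x y h]⟩, fun x hx => ?_⟩
    exact ⟨hS fun i => (hx i).1, hT fun i => (hx i).2⟩

variable {U}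

theorem mem_iterFilter {P : Set (L → X)} :
    P ∈ iterFilter U ↔ ∃ S : Strategy U, S.runs ⊆ P := Iff.rfl

instance iterFilter_neBot [WellFoundedLT L] [Nonempty X] : (iterFilter U).NeBot := by
  refine ⟨fun h => ?_⟩
  obtain ⟨S, hS⟩ := mem_iterFilter.1 (h ▸ mem_bot : (∅ : Set (L → X)) ∈ iterFilter U)
  obtain ⟨x, hx⟩ := S.runs_nonempty
  exact hS hx

theorem iterFilter_cardinalInter {c : Cardinal.{u}}
    (h : ∀ i, CardinalInterFilter ((U i).1 : Filter X) c) :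
    CardinalInterFilter (iterFilter U) c := by
  refine ⟨fun 𝒮 h𝒮 hmem => ?_⟩
  choose S hS using fun P : 𝒮 => mem_iterFilter.1 (hmem P.1 P.2)
  refine ⟨⟨fun i x => ⋂ P : 𝒮, (S P).toFun i x, fun i x => ?_, fun i x y hxy => ?_⟩, ?_⟩
  · have := h i
    exact (cardinal_iInter_mem h𝒮).2 fun P => (S P).mem i x
  · exact iInter_congr fun P => (S P).local_eq i x y hxy
  · intro x hx P hP
    exact hS ⟨P, hP⟩ fun i => mem_iInter.1 (hx i) ⟨P, hP⟩

instance iterFilter_countableInter : CountableInterFilter (iterFilter U) := by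
  refine @CardinalInterFilter.toCountableInterFilter _ _ _
    (iterFilter_cardinalInter (c := ℵ₁) fun i => ?_) aleph0_lt_aleph_one
  exact cardinalInterFilter_aleph_one_iff.2 (U i).2

/-- A property that depends on coordinates up to `a` can be checked at coordinate `a` last. -/
theorem eventually_of_update {P : (L → X) → Prop} {a : L} {s : Finset L} (hs : ∀ i ∈ s, i < a)
    (hP : DependsOn P ((insert a s : Finset L) : Set L))
    (h : ∀ᶠ x in iterFilter U, ∀ᶠ z in (U a).1, P (Function.update x a z)) :
    ∀ᶠ x in iterFilter U, P x := by
  classical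
  obtain ⟨S, hS⟩ := mem_iterFilter.1 h
  have hloc : ∀ x y : L → X, (∀ k < a, x k = y k) → ∀ z,
      P (Function.update x a z) = P (Function.update y a z) := by
    intro x y hxy z
    refine hP fun i hi => ?_
    rcases Finset.mem_insert.1 hi with rfl | hi
    · simp
    · simp [Function.update_of_ne (hs i hi).ne, hxy i (hs i hi)]
  -- Besides following `S`, the new strategy preserves `P` at stage `a`, but only at positions where
  -- almost every move does so. This guard keeps the prescribed sets large at all positions.
  refine ⟨⟨fun i x => S.toFun i x ∩ {z | i = a → (∀ᶠ z in (U a).1, P (Function.update x a z)) →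
    P (Function.update x a z)}, fun i x => inter_mem (S.mem i x) ?_, fun i x y hxy => ?_⟩, ?_⟩
  · by_cases hi : i = a
    · subst hi
      by_cases hg : ∀ᶠ z in (U i).1, P (Function.update x i z)
      · filter_upwards [hg] with z hz _ _ using hz
      · filter_upwards with z _ h' using absurd h' hg
    · filter_upwards with z h' using absurd h' hi
  · rw [S.local_eq i x y hxy]
    congr 1
    ext z
    by_cases hi : i = a
    · subst hi
      simp only [hloc x y hxy]
    · simp [hi]
  · intro x hx
    have h1 : ∀ᶠ z in (U a).1, P (Function.update x a z) := hS fun i => (hx i).1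
    have h2 := (hx a).2 rfl h1
    rwa [Function.update_eq_self] at h2

/-- The filter need not be an ultrafilter, but it decides events of finite support: the largest
coordinate is integrated out with its own ultrafilter, and the remaining event has smaller support.
-/
theorem FinSupp.eventually_or_not {P : (L → X) → Prop} (hP : FinSupp P) :
    (∀ᶠ x in iterFilter U, P x) ∨ ∀ᶠ x in iterFilter U, ¬ P x := by
  classical
  obtain ⟨s, hs⟩ := hP
  induction s using Finset.induction_on_max generalizing P with
  | empty =>
    by_cases h : ∃ x, P x
    · obtain ⟨x, hx⟩ := h
      left
      exact Eventually.of_forall fun y => (hs (x := x) (y := y) (by simp)).mp hx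
    · right
      exact Eventually.of_forall fun y hy => h ⟨y, hy⟩
  | insert a s has ih =>
    have hdep : DependsOn (fun x : L → X => ∀ᶠ z in (U a).1, P (Function.update x a z))
        (s : Set L) := by
      intro x y hxy
      have : ∀ z, P (Function.update x a z) = P (Function.update y a z) := fun z =>
        hs fun i hi => by
          rcases Finset.mem_insert.1 hi with rfl | hi
          · simp
          · simp [Function.update_of_ne (has i hi).ne, hxy i hi]
      simp only [this]
    rcases ih hdep with h | h
    · exact .inl (eventually_of_update has hs h)
    · refine .inr (eventually_of_update (P := fun x => ¬ P x) has
        (fun x y hxy => congrArg Not (hs hxy)) ?_)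
      filter_upwards [h] with x hx
      exact Ultrafilter.eventually_not.2 hx

theorem FinSupp.eventually_not [WellFoundedLT L] [Nonempty X] {P : (L → X) → Prop}
    (hP : FinSupp P) :
    (∀ᶠ x in iterFilter U, ¬ P x) ↔ ¬ ∀ᶠ x in iterFilter U, P x := by
  refine ⟨fun h h' => ?_, fun h => hP.eventually_or_not.resolve_left h⟩
  obtain ⟨x, hx⟩ := (h.and h').exists
  exact hx.1 hx.2

/-- Restriction of plays along an embedding of index orders. -/
theorem tendsto_pull {L' : Type u} [LinearOrder L'] {U' : L' → CUltrafilter X} {e : L → L'}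
    (he : StrictMono e) (hU : ∀ i, U' (e i) = U i) :
    Tendsto (fun x : L' → X => x ∘ e) (iterFilter U') (iterFilter U) := by
  rintro P ⟨S, hS⟩
  refine ⟨⟨fun i x => {z | ∀ k, e k = i → z ∈ S.toFun k (x ∘ e)}, fun i x => ?_,
    fun i x y hxy => ?_⟩, ?_⟩
  · by_cases h : ∃ k, e k = i
    · obtain ⟨k, rfl⟩ := h
      rw [hU]
      filter_upwards [S.mem k (x ∘ e)] with z hz k' hk'
      rwa [he.injective hk']
    · filter_upwards with z k hk using absurd ⟨k, hk⟩ h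
  · ext z
    refine forall_congr' fun k => forall_congr' fun hk => ?_
    rw [S.local_eq k (x ∘ e) (y ∘ e) fun k' hk' => hxy _ (hk ▸ he hk')]
  · intro x hx
    exact hS fun k => hx (e k) k rfl

theorem FinSupp.eventually_pull_iff {L' : Type u} [LinearOrder L'] [WellFoundedLT L']
    [Nonempty X] {U' : L' → CUltrafilter X} {e : L → L'}
    (he : StrictMono e) (hU : ∀ i, U' (e i) = U i) {P : (L → X) → Prop} (hP : FinSupp P) :
    (∀ᶠ x in iterFilter U', P (x ∘ e)) ↔ ∀ᶠ x in iterFilter U, P x := by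
  refine ⟨fun h => hP.eventually_or_not.resolve_right fun h' => ?_,
    fun h => (tendsto_pull he hU).eventually h⟩
  obtain ⟨x, hx⟩ := (h.and ((tendsto_pull he hU).eventually h')).exists
  exact hx.2 hx.1

end Filter

/-! ### Concatenation of index orders -/

section Concat

variable {E Q N X : Type u} [LinearOrder E] [LinearOrder Q] [LinearOrder N]

/-- `N` is the concatenation of `E` and `Q`. -/
structure IsConcat (e₁ : E → N) (e₂ : Q → N) : Prop where
  mono₁ : StrictMono e₁
  mono₂ : StrictMono e₂
  lt : ∀ a q, e₁ a < e₂ q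
  cover : ∀ n, (∃ a, e₁ a = n) ∨ ∃ q, e₂ q = n

/-- The play on `N` that is put together from plays on `E` and `Q`. -/
noncomputable def join [Nonempty X] (e₁ : E → N) (e₂ : Q → N) (x : E → X) (z : Q → X) : N → X :=
  Function.extend e₁ x (Function.extend e₂ z fun _ => Classical.arbitrary X)

variable [Nonempty X] {e₁ : E → N} {e₂ : Q → N}

theorem join_left (hc : IsConcat e₁ e₂) (x : E → X) (z : Q → X) (a : E) :
    join e₁ e₂ x z (e₁ a) = x a :=
  hc.mono₁.injective.extend_apply _ _ _

theorem join_right (hc : IsConcat e₁ e₂) (x : E → X) (z : Q → X) (q : Q) :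
    join e₁ e₂ x z (e₂ q) = z q := by
  rw [join, Function.extend_apply', hc.mono₂.injective.extend_apply]
  rintro ⟨a, ha⟩
  exact (hc.lt a q).ne ha

/-- This is the Fubini property. Once a play on `E` follows the strategy, what is left of the
strategy is a strategy on `Q`. -/
theorem eventually_join (hc : IsConcat e₁ e₂) {U : N → CUltrafilter X} {P : (N → X) → Prop}
    (hP : ∀ᶠ w in iterFilter U, P w) :
    ∀ᶠ x in iterFilter fun a => U (e₁ a), ∀ᶠ z in iterFilter fun q => U (e₂ q),
      P (join e₁ e₂ x z) := by
  obtain ⟨S, hS⟩ := hP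
  -- Stages of `E` precede all stages of `Q`, so what is prescribed there is independent of the play
  -- on `Q`.
  have key : ∀ (a : E) (x y : E → X) (z z' : Q → X), (∀ k < a, x k = y k) →
      S.toFun (e₁ a) (join e₁ e₂ x z) = S.toFun (e₁ a) (join e₁ e₂ y z') := by
    intro a x y z z' hxy
    refine S.local_eq _ _ _ fun k hk => ?_
    rcases hc.cover k with ⟨b, rfl⟩ | ⟨q, rfl⟩
    · rw [join_left hc, join_left hc]
      exact hxy b (hc.mono₁.lt_iff_lt.1 hk)
    · exact absurd hk (hc.lt a q).not_gt
  let z₀ : Q → X := fun _ => Classical.arbitrary X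
  refine ⟨⟨fun a x => S.toFun (e₁ a) (join e₁ e₂ x z₀), fun a x => S.mem _ _,
    fun a x y hxy => key a x y _ _ hxy⟩, fun x hx => ?_⟩
  refine ⟨⟨fun q z => S.toFun (e₂ q) (join e₁ e₂ x z), fun q z => S.mem _ _,
    fun q z z' hzz => S.local_eq _ _ _ fun k hk => ?_⟩, fun z hz => hS fun n => ?_⟩
  · rcases hc.cover k with ⟨b, rfl⟩ | ⟨q', rfl⟩
    · rw [join_left hc, join_left hc]
    · rw [join_right hc, join_right hc]
      exact hzz q' (hc.mono₂.lt_iff_lt.1 hk)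
  · rcases hc.cover n with ⟨a, rfl⟩ | ⟨q, rfl⟩
    · rw [join_left hc, key a x x z z₀ fun _ _ => rfl]
      exact hx a
    · rw [join_right hc]
      exact hz q

end Concat

/-! ### The transitive collapse of the iterated ultrapower of the universe -/

section Collapse

variable {L X : Type u} [LinearOrder L] [WellFoundedLT L] [Nonempty X] (U : L → CUltrafilter X)

/-- Membership in the iterated ultrapower. -/
def UMem (G F : (L → X) → ZFSet.{u}) : Prop := FinSupp G ∧ ∀ᶠ x in iterFilter U, G x ∈ F x

/-- By countable completeness, the memberships of a descending chain hold simultaneously at a single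
play, which contradicts foundation. -/
theorem wellFounded_uMem : WellFounded (UMem U) := by
  rw [wellFounded_iff_isEmpty_descending_chain]
  refine ⟨fun ⟨f, hf⟩ => ?_⟩
  have h : ∀ᶠ x in iterFilter U, ∀ n, f (n + 1) x ∈ f n x :=
    eventually_countable_forall.2 fun n => (hf n).2
  obtain ⟨x, hx⟩ := h.exists
  exact (wellFounded_iff_isEmpty_descending_chain.1 ZFSet.mem_wf).false ⟨fun n => f n x, hx⟩

/-- The members of `F` in the ultrapower that are represented by selectors of `F`. -/
def Selector (F : (L → X) → ZFSet.{u}) : Type (u + 1) :=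
  {G : (L → X) → ZFSet.{u} // UMem U G F ∧ ∀ x, G x ∈ insert ∅ (F x)}

/-- The values of a selector lie in fixed sets, so the selectors form a set although the members of
`F` form a proper class. This makes the recursion for `collapse` possible; nothing is lost, since
each member agrees almost everywhere with a selector. -/
instance small_selector (F : (L → X) → ZFSet.{u}) : Small.{u} (Selector U F) := by
  have h : Small.{u} (∀ x : L → X, (insert ∅ (F x) : ZFSet.{u})) := inferInstance
  refine small_of_injective (β := ∀ x : L → X, (insert ∅ (F x) : ZFSet.{u}))
    (f := fun G x => ⟨G.1 x, G.2.2 x⟩) fun G G' hG => Subtype.ext (funext fun x => ?_)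
  exact congrArg Subtype.val (congrFun hG x)

/-- The transitive collapse of the iterated ultrapower, on representing functions. -/
noncomputable def collapse : ((L → X) → ZFSet.{u}) → ZFSet.{u} :=
  (wellFounded_uMem U).fix fun F c => ZFSet.range fun G : Selector U F => c G.1 G.2.1

theorem collapse_eq (F : (L → X) → ZFSet.{u}) :
    collapse U F = ZFSet.range fun G : Selector U F => collapse U G.1 :=
  WellFounded.fix_eq _ _ _

variable {U}

theorem collapse_congr {F F' : (L → X) → ZFSet.{u}} (h : F =ᶠ[iterFilter U] F')
    (hF : FinSupp F) (hF' : FinSupp F') :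
    collapse U F = collapse U F' := by
  classical
  have key : ∀ F : (L → X) → ZFSet.{u}, FinSupp F → ∀ F', FinSupp F' →
      F =ᶠ[iterFilter U] F' → collapse U F ⊆ collapse U F' ∧ collapse U F' ⊆ collapse U F := by
    intro F
    induction F using (wellFounded_uMem U).induction with
    | _ F ih =>
      intro hF F' hF' h
      -- A member of `A` becomes a selector of `B` by changing its value to `∅` wherever it is not
      -- in `B x`, which happens on a null set only.
      have sel : ∀ {A B : (L → X) → ZFSet.{u}} (G : (L → X) → ZFSet.{u}), FinSupp B →
          FinSupp G → A =ᶠ[iterFilter U] B → (∀ᶠ x in iterFilter U, G x ∈ A x) →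
          ∃ G' : Selector U B, G =ᶠ[iterFilter U] G'.1 := by
        intro A B G hB hG hAB hGA
        have hae : G =ᶠ[iterFilter U] fun x => if G x ∈ B x then G x else ∅ := by
          filter_upwards [hAB, hGA] with x h1 h2
          rw [if_pos (h1 ▸ h2)]
        refine ⟨⟨fun x => if G x ∈ B x then G x else ∅,
          ⟨hG.comp₂ hB fun a b => if a ∈ b then a else ∅, ?_⟩, fun x => ?_⟩, hae⟩
        · filter_upwards [hAB, hGA] with x h1 h2
          rw [if_pos (h1 ▸ h2)]
          exact h1 ▸ h2
        · dsimp only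
          split_ifs with hx <;> simp [hx]
      constructor
      · intro y hy
        rw [collapse_eq, ZFSet.mem_range] at hy ⊢
        obtain ⟨G, rfl⟩ := hy
        obtain ⟨G', hG'⟩ := sel G.1 hF' G.2.1.1 h G.2.1.2
        have := ih G.1 G.2.1 G.2.1.1 G'.1 G'.2.1.1 hG'
        exact ⟨G', subset_antisymm this.2 this.1⟩
      · intro y hy
        rw [collapse_eq, ZFSet.mem_range] at hy ⊢
        obtain ⟨G, rfl⟩ := hy
        obtain ⟨G', hG'⟩ := sel G.1 hF G.2.1.1 h.symm G.2.1.2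
        have := ih G'.1 G'.2.1 G'.2.1.1 G.1 G.2.1.1 hG'.symm
        exact ⟨G', subset_antisymm this.1 this.2⟩
  have := key F hF F' hF' h
  exact subset_antisymm this.1 this.2

theorem mem_collapse {F : (L → X) → ZFSet.{u}} {y : ZFSet.{u}} :
    y ∈ collapse U F ↔
      ∃ G, FinSupp G ∧ (∀ x, G x ∈ insert ∅ (F x)) ∧ (∀ᶠ x in iterFilter U, G x ∈ F x) ∧
        collapse U G = y := by
  rw [collapse_eq, ZFSet.mem_range]
  exact ⟨fun ⟨G, h⟩ => ⟨G.1, G.2.1.1, G.2.2, G.2.1.2, h⟩,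
    fun ⟨G, h1, h2, h3, h4⟩ => ⟨⟨G, ⟨h1, h3⟩, h2⟩, h4⟩⟩

theorem collapse_mem_of {F G : (L → X) → ZFSet.{u}} (hF : FinSupp F) (hG : FinSupp G)
    (h : ∀ᶠ x in iterFilter U, G x ∈ F x) : collapse U G ∈ collapse U F := by
  classical
  have hae : (fun x => if G x ∈ F x then G x else ∅) =ᶠ[iterFilter U] G := by
    filter_upwards [h] with x hx
    rw [if_pos hx]
  have hfs : FinSupp fun x => if G x ∈ F x then G x else ∅ :=
    hG.comp₂ hF fun a b => if a ∈ b then a else ∅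
  refine mem_collapse.2 ⟨_, hfs, fun x => ?_, ?_, collapse_congr hae hfs hG⟩
  · split_ifs with hx <;> simp [hx]
  · filter_upwards [h] with x hx
    rwa [if_pos hx]

theorem collapse_eq_iff {F G : (L → X) → ZFSet.{u}} (hF : FinSupp F) (hG : FinSupp G) :
    collapse U F = collapse U G ↔ ∀ᶠ x in iterFilter U, F x = G x := by
  classical
  refine ⟨?_, fun h => collapse_congr h hF hG⟩
  induction F using (wellFounded_uMem U).induction generalizing G with
  | _ F ih =>
    intro hFG
    by_contra hne
    have hne' : ∀ᶠ x in iterFilter U, ¬ F x = G x :=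
      (hF.comp₂ hG (· = ·)).eventually_or_not.resolve_left hne
    -- A witness against extensionality is chosen as a function of the two values, so that it
    -- inherits finite support and is available in the ultrapower.
    have hex : ∀ a b : ZFSet.{u}, ∃ w, a ≠ b → (w ∈ a ∧ w ∉ b) ∨ (w ∈ b ∧ w ∉ a) := by
      intro a b
      by_cases hab : a = b
      · exact ⟨∅, fun h => absurd hab h⟩
      · by_contra! hcon
        refine hab (ZFSet.ext fun w => ?_)
        have := hcon w
        tauto
    choose w hw using hex
    have hH : FinSupp fun x => w (F x) (G x) := hF.comp₂ hG w
    have hor : (∀ᶠ x in iterFilter U, w (F x) (G x) ∈ F x ∧ w (F x) (G x) ∉ G x) ∨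
        ∀ᶠ x in iterFilter U, w (F x) (G x) ∈ G x ∧ w (F x) (G x) ∉ F x := by
      rcases (hF.comp₂ hG fun a b => w a b ∈ a ∧ w a b ∉ b).eventually_or_not (U := U)
        with h | h
      · exact .inl h
      · right
        filter_upwards [h, hne'] with x h1 h2 using (hw _ _ h2).resolve_left h1
    rcases hor with h | h
    · have h1 := collapse_mem_of (U := U) hF hH (h.mono fun _ h => h.1)
      rw [hFG] at h1
      obtain ⟨H', hH', -, hH'G, he⟩ := mem_collapse.1 h1
      have h2 := ih _ ⟨hH, h.mono fun _ h => h.1⟩ hH hH' he.symm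
      obtain ⟨x, h3, h4, h5⟩ := (h2.and (h.and hH'G)).exists
      exact h4.2 (h3 ▸ h5)
    · have h1 := collapse_mem_of (U := U) hG hH (h.mono fun _ h => h.1)
      rw [← hFG] at h1
      obtain ⟨H', hH', -, hH'F, he⟩ := mem_collapse.1 h1
      have h2 := ih _ ⟨hH', hH'F⟩ hH' hH he
      obtain ⟨x, h3, h4, h5⟩ := (h2.and (h.and hH'F)).exists
      exact h4.2 (h3 ▸ h5)

theorem collapse_mem_iff {F G : (L → X) → ZFSet.{u}} (hF : FinSupp F) (hG : FinSupp G) :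
    collapse U G ∈ collapse U F ↔ ∀ᶠ x in iterFilter U, G x ∈ F x := by
  refine ⟨fun h => ?_, collapse_mem_of hF hG⟩
  obtain ⟨H, hH, -, hHF, he⟩ := mem_collapse.1 h
  filter_upwards [(collapse_eq_iff hH hG).1 he, hHF] with x h1 h2 using h1 ▸ h2

variable (U)

/-- The embedding of the universe into the iterated ultrapower. -/
noncomputable def emb (y : ZFSet.{u}) : ZFSet.{u} := collapse U fun _ => y

variable {U}

theorem emb_injective : Function.Injective (emb U) := fun y z h => by
  obtain ⟨x, hx⟩ := ((collapse_eq_iff (.const y) (.const z)).1 h).exists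
  exact hx

end Collapse

/-! ### The theorem of Łoś for bounded formulas -/

section Los

open PerfectSubset FirstOrder Language BoundedFormula

theorem langSet_term_eq_var {β : Type} (t : langSet.Term β) : ∃ v, t = Term.var v := by
  cases t with
  | var v => exact ⟨v, rfl⟩
  | func f _ => exact f.elim

theorem realize_memFormula {α : Type} {n : ℕ} (t s : langSet.Term (α ⊕ Fin n))
    (v : α → ZFSet.{u}) (xs : Fin n → ZFSet.{u}) :
    (memFormula t s).Realize v xs ↔
      t.realize (Sum.elim v xs) ∈ s.realize (Sum.elim v xs) := by
  rw [memFormula, BoundedFormula.realize_rel₂]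
  rfl

theorem realize_lastVar {α : Type} {n : ℕ} (v : α → ZFSet.{u}) (xs : Fin n → ZFSet.{u})
    (a : ZFSet.{u}) :
    (lastVar : langSet.Term (α ⊕ Fin (n + 1))).realize (Sum.elim v (Fin.snoc xs a)) = a := by
  simp [lastVar]

theorem realize_liftVar {α : Type} {n : ℕ} (w : α ⊕ Fin n) (v : α → ZFSet.{u})
    (xs : Fin n → ZFSet.{u}) (a : ZFSet.{u}) :
    (liftVar w).realize (Sum.elim v (Fin.snoc xs a)) = Sum.elim v xs w := by
  cases w <;> simp [liftVar]

variable {L X : Type u} [LinearOrder L] [WellFoundedLT L] [Nonempty X] {U : L → CUltrafilter X}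

/-- The left side is evaluated in the whole universe. This is harmless for Δ₀ formulas, since every
element of a collapse is again a collapse of a function of finite support. -/
theorem realize_collapse_iff {α : Type} [Finite α] {n : ℕ} {φ : langSet.BoundedFormula α n}
    (hφ : IsDelta0 φ) (v : α → (L → X) → ZFSet.{u}) (xs : Fin n → (L → X) → ZFSet.{u})
    (hv : ∀ a, FinSupp (v a)) (hxs : ∀ i, FinSupp (xs i)) :
    φ.Realize (fun a => collapse U (v a)) (fun i => collapse U (xs i)) ↔
      ∀ᶠ x in iterFilter U, φ.Realize (fun a => v a x) (fun i => xs i x) := by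
  have supp : ∀ {m : ℕ} {β : Type (u + 1)} (xs : Fin m → (L → X) → ZFSet.{u})
      (g : (α → ZFSet.{u}) → (Fin m → ZFSet.{u}) → β),
      (∀ i, FinSupp (xs i)) → FinSupp fun x => g (fun a => v a x) (fun i => xs i x) :=
    fun xs g hxs => (FinSupp.pi hv).comp₂ (FinSupp.pi hxs) g
  have suppP : ∀ {m : ℕ} (xs : Fin m → (L → X) → ZFSet.{u})
      (g : (α → ZFSet.{u}) → (Fin m → ZFSet.{u}) → Prop),
      (∀ i, FinSupp (xs i)) → FinSupp fun x => g (fun a => v a x) (fun i => xs i x) :=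
    fun xs g hxs => (FinSupp.pi hv).comp₂ (FinSupp.pi hxs) g
  have elim : ∀ {m : ℕ} (xs : Fin m → (L → X) → ZFSet.{u}) (w : α ⊕ Fin m),
      Sum.elim (fun a => collapse U (v a)) (fun i => collapse U (xs i)) w =
        collapse U (fun x => Sum.elim (fun a => v a x) (fun i => xs i x) w) := by
    rintro m xs (w | w) <;> rfl
  have snoc : ∀ {m : ℕ} (xs : Fin m → (L → X) → ZFSet.{u}) (G : (L → X) → ZFSet.{u}),
      (Fin.snoc (fun i => collapse U (xs i)) (collapse U G) : Fin (m + 1) → ZFSet.{u}) =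
        fun i => collapse U ((Fin.snoc xs G : Fin (m + 1) → (L → X) → ZFSet.{u}) i) := by
    intro m xs G
    funext i
    refine Fin.lastCases ?_ (fun i => ?_) i <;> simp
  have snoc' : ∀ {m : ℕ} (xs : Fin m → (L → X) → ZFSet.{u}) (G : (L → X) → ZFSet.{u}) (x),
      (fun i => (Fin.snoc xs G : Fin (m + 1) → (L → X) → ZFSet.{u}) i x) =
        (Fin.snoc (fun i => xs i x) (G x) : Fin (m + 1) → ZFSet.{u}) := by
    intro m xs G x
    funext i
    refine Fin.lastCases ?_ (fun i => ?_) i <;> simp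
  have snocS : ∀ {m : ℕ} (xs : Fin m → (L → X) → ZFSet.{u}) (G : (L → X) → ZFSet.{u}),
      (∀ i, FinSupp (xs i)) → FinSupp G →
      ∀ i, FinSupp ((Fin.snoc xs G : Fin (m + 1) → (L → X) → ZFSet.{u}) i) := by
    intro m xs G hxs hG i
    refine Fin.lastCases ?_ (fun i => ?_) i <;> simp [hG, hxs]
  have elimS : ∀ {m : ℕ} (xs : Fin m → (L → X) → ZFSet.{u}) (w : α ⊕ Fin m),
      (∀ i, FinSupp (xs i)) →
      FinSupp (fun x => Sum.elim (fun a => v a x) (fun i => xs i x) w) := by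
    rintro m xs (w | w) h
    exacts [hv w, h w]
  -- a bounded existential quantifier over a `Δ₀` matrix
  have bdd : ∀ {m : ℕ} (w : α ⊕ Fin m) (xs : Fin m → (L → X) → ZFSet.{u})
      (_ : ∀ i, FinSupp (xs i)) (R : (α → ZFSet.{u}) → (Fin (m + 1) → ZFSet.{u}) → Prop)
      (_ : ∀ ys : Fin (m + 1) → (L → X) → ZFSet.{u}, (∀ i, FinSupp (ys i)) →
        (R (fun a => collapse U (v a)) (fun i => collapse U (ys i)) ↔
          ∀ᶠ x in iterFilter U, R (fun a => v a x) (fun i => ys i x))),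
      (∃ a ∈ collapse U (fun x => Sum.elim (fun a => v a x) (fun i => xs i x) w),
        R (fun a => collapse U (v a)) (Fin.snoc (fun i => collapse U (xs i)) a)) ↔
      ∀ᶠ x in iterFilter U, ∃ a ∈ Sum.elim (fun a => v a x) (fun i => xs i x) w,
        R (fun a => v a x) (Fin.snoc (fun i => xs i x) a) := by
    intro m w xs hxs R hR
    constructor
    · rintro ⟨a, ha, hRa⟩
      obtain ⟨G, hG, -, hGm, rfl⟩ := mem_collapse.1 ha
      rw [snoc, hR _ (snocS xs G hxs hG)] at hRa
      filter_upwards [hRa, hGm] with x h1 h2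
      exact ⟨G x, h2, by rwa [snoc'] at h1⟩
    · intro h
      -- Witnesses are chosen from the values of the finitely many parameters, which gives a witness
      -- function of finite support.
      have hch : ∀ (p : α → ZFSet.{u}) (q : Fin m → ZFSet.{u}), ∃ a,
          (∃ a ∈ Sum.elim p q w, R p (Fin.snoc q a)) →
            a ∈ Sum.elim p q w ∧ R p (Fin.snoc q a) := by
        intro p q
        by_cases hpq : ∃ a ∈ Sum.elim p q w, R p (Fin.snoc q a)
        · obtain ⟨a, ha⟩ := hpq
          exact ⟨a, fun _ => ha⟩
        · exact ⟨∅, fun h => absurd h hpq⟩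
      choose g hg using hch
      have hG := supp xs g hxs
      refine ⟨collapse U fun x => g (fun a => v a x) (fun i => xs i x),
        collapse_mem_of (elimS xs w hxs) hG ?_, ?_⟩
      · filter_upwards [h] with x hx using (hg _ _ hx).1
      · rw [snoc, hR _ (snocS xs _ hxs hG)]
        filter_upwards [h] with x hx
        rw [snoc']
        exact (hg _ _ hx).2
  induction hφ with
  | falsum =>
    simp only [BoundedFormula.Realize, eventually_false_iff_eq_bot, false_iff]
    exact NeBot.ne inferInstance
  | equal t s =>
    obtain ⟨t, rfl⟩ := langSet_term_eq_var t
    obtain ⟨s, rfl⟩ := langSet_term_eq_var s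
    simp only [BoundedFormula.Realize, Term.realize_var, elim]
    exact collapse_eq_iff (elimS xs t hxs) (elimS xs s hxs)
  | mem t s =>
    obtain ⟨t, rfl⟩ := langSet_term_eq_var t
    obtain ⟨s, rfl⟩ := langSet_term_eq_var s
    simp only [realize_memFormula, Term.realize_var, elim]
    exact collapse_mem_iff (elimS xs s hxs) (elimS xs t hxs)
  | @imp m φ ψ _ _ ih1 ih2 =>
    refine BoundedFormula.realize_imp.trans
      ((imp_congr (ih1 xs hxs) (ih2 xs hxs)).trans ?_)
    constructor
    · intro h
      rcases (suppP xs (fun p q => φ.Realize p q) hxs).eventually_or_not (U := U) with h1 | h1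
      · filter_upwards [h h1] with x hx _ using hx
      · filter_upwards [h1] with x hx hx' using absurd hx' hx
    · intro h h1
      filter_upwards [h, h1] with x h2 h3 using h2 h3
  | @ball m w φ _ ih =>
    -- The bounded universal quantifier is the dual of the existential one; negation commutes with
    -- the filter on events of finite support.
    have := bdd w xs hxs (fun p q => ¬ φ.Realize p q) fun ys hys =>
      (not_congr (ih ys hys)).trans
        (suppP ys (fun p q => φ.Realize p q) hys).eventually_not.symm
    have h2 := not_congr this
    have hsupp := suppP xs (fun p q => ∃ a ∈ Sum.elim p q w, ¬ φ.Realize p (Fin.snoc q a)) hxs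
    rw [← hsupp.eventually_not] at h2
    simp only [BoundedFormula.realize_all, BoundedFormula.realize_imp, realize_memFormula,
      realize_lastVar, realize_liftVar, elim]
    push Not at h2
    exact h2
  | @bex m w φ _ ih =>
    have := bdd w xs hxs (fun p q => φ.Realize p q) ih
    simp only [BoundedFormula.realize_ex, BoundedFormula.realize_inf, realize_memFormula,
      realize_lastVar, realize_liftVar, elim]
    exact this

theorem realize_emb_of_sigma1 {α : Type} [Finite α] {n : ℕ} {φ : langSet.BoundedFormula α n}
    (hφ : IsSigma1 φ) (v : α → ZFSet.{u}) (xs : Fin n → ZFSet.{u}) (h : φ.Realize v xs) :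
    φ.Realize (fun a => emb U (v a)) (fun i => emb U (xs i)) := by
  induction hφ with
  | of_delta0 hφ =>
    exact (realize_collapse_iff hφ (fun a _ => v a) (fun i _ => xs i) (fun _ => .const _)
      fun _ => .const _).2 (Eventually.of_forall fun _ => h)
  | ex _ ih =>
    rw [BoundedFormula.realize_ex] at h ⊢
    obtain ⟨a, ha⟩ := h
    refine ⟨emb U a, ?_⟩
    convert ih _ ha using 1
    funext i
    refine Fin.lastCases ?_ (fun i => ?_) i <;> simp

end Los

/-! ### Ordinals in the iterated ultrapower -/

section Ordinals

variable {L X : Type u} [LinearOrder L] [WellFoundedLT L] [Nonempty X] {U : L → CUltrafilter X}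

theorem isOrdinal_collapse {F : (L → X) → ZFSet.{u}} (hFs : FinSupp F)
    (hF : ∀ x, (F x).IsOrdinal) : (collapse U F).IsOrdinal := by
  induction F using (wellFounded_uMem U).induction with
  | _ F ih =>
    rw [ZFSet.isOrdinal_iff_forall_mem_isOrdinal]
    refine ⟨fun y hy z hz => ?_, fun y hy => ?_⟩
    · obtain ⟨G, hG, -, hGF, rfl⟩ := mem_collapse.1 hy
      obtain ⟨H, hH, -, hHG, rfl⟩ := mem_collapse.1 hz
      refine collapse_mem_of hFs hH ?_
      filter_upwards [hGF, hHG] with x h1 h2 using (hF x).mem_trans h2 h1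
    · obtain ⟨G, hG, hG', hGF, rfl⟩ := mem_collapse.1 hy
      refine ih G ⟨hG, hGF⟩ hG fun x => ?_
      rcases ZFSet.mem_insert_iff.1 (hG' x) with h | h
      · rw [h]
        exact ZFSet.isOrdinal_empty
      · exact (hF x).mem h

variable (U)

/-- The ordinal that is represented by an ordinal valued function in the iterated ultrapower. -/
noncomputable def ocollapse (h : (L → X) → Ordinal.{u}) : Ordinal.{u} :=
  (collapse U fun x => (h x).toZFSet).rank

/-- The restriction of the embedding into the iterated ultrapower to the ordinals. -/
noncomputable def oemb (θ : Ordinal.{u}) : Ordinal.{u} := ocollapse U fun _ => θ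

variable {U}

theorem toZFSet_ocollapse {h : (L → X) → Ordinal.{u}} (hh : FinSupp h) :
    (ocollapse U h).toZFSet = collapse U fun x => (h x).toZFSet :=
  (isOrdinal_collapse (hh.comp _) fun x => ZFSet.isOrdinal_toZFSet (h x)).toZFSet_rank_eq

theorem emb_toZFSet (θ : Ordinal.{u}) : emb U θ.toZFSet = (oemb U θ).toZFSet :=
  (toZFSet_ocollapse (.const θ)).symm

theorem ocollapse_lt_iff {g h : (L → X) → Ordinal.{u}} (hg : FinSupp g) (hh : FinSupp h) :
    ocollapse U g < ocollapse U h ↔ ∀ᶠ x in iterFilter U, g x < h x := by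
  rw [← Ordinal.toZFSet_mem_toZFSet_iff, toZFSet_ocollapse hg, toZFSet_ocollapse hh,
    collapse_mem_iff (hh.comp _) (hg.comp _)]
  simp only [Ordinal.toZFSet_mem_toZFSet_iff]

theorem ocollapse_eq_iff {g h : (L → X) → Ordinal.{u}} (hg : FinSupp g) (hh : FinSupp h) :
    ocollapse U g = ocollapse U h ↔ ∀ᶠ x in iterFilter U, g x = h x := by
  rw [← Ordinal.toZFSet_injective.eq_iff, toZFSet_ocollapse hg, toZFSet_ocollapse hh,
    collapse_eq_iff (hg.comp _) (hh.comp _)]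
  simp only [Ordinal.toZFSet_injective.eq_iff]

/-- The alternative `g x = 0` is the default value `∅` of selectors, here read as an ordinal. -/
theorem exists_ocollapse_eq {h : (L → X) → Ordinal.{u}} (hh : FinSupp h) {θ : Ordinal.{u}}
    (hθ : θ < ocollapse U h) :
    ∃ g : (L → X) → Ordinal.{u}, FinSupp g ∧ (∀ x, g x < h x ∨ g x = 0) ∧
      (∀ᶠ x in iterFilter U, g x < h x) ∧ ocollapse U g = θ := by
  rw [← Ordinal.toZFSet_mem_toZFSet_iff, toZFSet_ocollapse hh] at hθ
  obtain ⟨G, hG, hG', hGh, he⟩ := mem_collapse.1 hθ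
  have hlt : ∀ x, G x ∈ (h x).toZFSet → (G x).rank < h x := by
    intro x hx
    have := ZFSet.rank_lt_of_mem hx
    rwa [Ordinal.rank_toZFSet] at this
  have hG2 : ∀ x, (G x).rank.toZFSet = G x := by
    intro x
    refine ZFSet.IsOrdinal.toZFSet_rank_eq ?_
    rcases ZFSet.mem_insert_iff.1 (hG' x) with h1 | h1
    · rw [h1]
      exact ZFSet.isOrdinal_empty
    · exact (ZFSet.isOrdinal_toZFSet _).mem h1
  refine ⟨fun x => (G x).rank, hG.comp _, fun x => ?_, ?_, ?_⟩
  · rcases ZFSet.mem_insert_iff.1 (hG' x) with h1 | h1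
    · exact .inr (by simp [h1])
    · exact .inl (hlt x h1)
  · filter_upwards [hGh] with x hx using hlt x hx
  · rw [ocollapse]
    simp only [hG2]
    rw [he, Ordinal.rank_toZFSet]

theorem oemb_strictMono : StrictMono (oemb U) := fun a b h =>
  (ocollapse_lt_iff (.const a) (.const b)).2 (Eventually.of_forall fun _ => h)

theorem le_oemb (θ : Ordinal.{u}) : θ ≤ oemb U θ := oemb_strictMono.le_apply

theorem toZFSet_ocollapse_mem_emb {h : (L → X) → Ordinal.{u}} (hh : FinSupp h) {y : ZFSet.{u}} :
    (ocollapse U h).toZFSet ∈ emb U y ↔ ∀ᶠ x in iterFilter U, (h x).toZFSet ∈ y := by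
  rw [toZFSet_ocollapse hh]
  exact collapse_mem_iff (.const y) (hh.comp _)

/-- Embeddings do not lower ordinals, so `θ` lies below the image of `c`, and a function that
represents it may be taken with values below `c`. -/
theorem exists_ocollapse_of_lt {c θ : Ordinal.{u}} (h : θ < c) :
    ∃ g : (L → X) → Ordinal.{u}, FinSupp g ∧ (∀ x, g x < c) ∧ ocollapse U g = θ := by
  obtain ⟨g, hg, hgc, -, he⟩ :=
    exists_ocollapse_eq (U := U) (.const c) (h.trans_le (le_oemb (U := U) c))
  exact ⟨g, hg, fun x => (hgc x).elim id fun h0 => h0 ▸ pos_of_gt h, he⟩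

theorem emb_subset {y z : ZFSet.{u}} (h : y ⊆ z) : emb U y ⊆ emb U z := by
  intro w hw
  obtain ⟨G, hG, -, hGy, rfl⟩ := mem_collapse.1 hw
  exact collapse_mem_of (.const z) hG (hGy.mono fun x hx => h hx)

end Ordinals

/-! ### Independence of the later stages -/

section EndExtension

variable {L X : Type u} [LinearOrder L] {U : L → CUltrafilter X}

/-- The set `K` has fewer than `c` elements. -/
def SmallSet {A : Type*} (c : Cardinal.{u}) (K : Set A) : Prop :=
  ∃ (τ : Type u) (φ : τ → A), #τ < c ∧ K ⊆ range φ

theorem eventually_update [WellFoundedLT L] [Nonempty X] {P : (L → X) → Prop} {a : L}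
    {s : Finset L} (hs : ∀ i ∈ s, i < a)
    (hP : DependsOn P ((insert a s : Finset L) : Set L)) (h : ∀ᶠ x in iterFilter U, P x) :
    ∀ᶠ x in iterFilter U, ∀ᶠ z in (U a).1, P (Function.update x a z) := by
  have hdep : DependsOn (fun x : L → X => ∀ᶠ z in (U a).1, P (Function.update x a z))
      (s : Set L) := by
    intro x y hxy
    have : ∀ z, P (Function.update x a z) = P (Function.update y a z) := fun z =>
      hP fun i hi => by
        rcases Finset.mem_insert.1 hi with rfl | hi
        · simp
        · simp [Function.update_of_ne (hs i hi).ne, hxy i hi]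
    simp only [this]
  refine (FinSupp.eventually_or_not ⟨s, hdep⟩).resolve_right fun h' => ?_
  have h2 := eventually_of_update (U := U) (P := fun x => ¬ P x) hs
    (fun x y hxy => congrArg Not (hP hxy))
    (h'.mono fun x hx => Ultrafilter.eventually_not.2 hx)
  obtain ⟨x, hx, hx'⟩ := (h.and h2).exists
  exact hx' hx

theorem _root_.Ultrafilter.eventually_eq_of_smallSet {A : Type*} {c : Cardinal.{u}}
    (V : Ultrafilter X) [CardinalInterFilter (V : Filter X) c] {K : Set A} (hK : SmallSet c K)
    {g : X → A} (hg : ∀ᶠ z in V, g z ∈ K) : ∃ a, ∀ᶠ z in V, g z = a := by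
  obtain ⟨τ, φ, hτ, hφ⟩ := hK
  by_contra hcon
  have h1 : ∀ᶠ z in (V : Filter X), ∀ t, g z ≠ φ t :=
    (eventually_cardinal_forall hτ).2 fun t => Ultrafilter.eventually_not.2 fun h => hcon ⟨_, h⟩
  obtain ⟨z, hz, hz'⟩ := (h1.and hg).exists
  obtain ⟨t, ht⟩ := hφ hz'
  exact hz t ht.symm

variable {L₁ : Type u} [LinearOrder L₁] [WellFoundedLT L] [Nonempty X]

/-- A function of finite support with few possible values, which depend on an initial part of the
play, depends on that initial part only. -/
theorem exists_eventually_eq_pull {A : Type*} {e : L₁ → L} (he : StrictMono e)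
    (hlow : ∀ i ∉ range e, ∀ a, e a < i) {c : Cardinal.{u}}
    (hc : ∀ i ∉ range e, CardinalInterFilter ((U i).1 : Filter X) c)
    {K : (L₁ → X) → Set A} (hKs : FinSupp K) (hK : ∀ x, SmallSet c (K x))
    {g : (L → X) → A} (hgs : FinSupp g) (hg : ∀ᶠ x in iterFilter U, g x ∈ K (x ∘ e)) :
    ∃ g' : (L₁ → X) → A, FinSupp g' ∧ ∀ᶠ x in iterFilter U, g x = g' (x ∘ e) := by
  classical
  obtain ⟨s, hs⟩ := hgs
  have : Nonempty A := ⟨g fun _ => Classical.arbitrary X⟩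
  induction s using Finset.induction_on_max generalizing g with
  | empty =>
    refine ⟨fun _ => g fun _ => Classical.arbitrary X, .const _, Eventually.of_forall fun x => ?_⟩
    exact hs (by simp)
  | insert a s has ih =>
    by_cases ha : a ∈ range e
    · have hsub : ∀ i ∈ insert a s, i ∈ range e := by
        intro i hi
        rcases Finset.mem_insert.1 hi with rfl | his
        · exact ha
        · by_contra hi'
          obtain ⟨b, rfl⟩ := ha
          exact (hlow i hi' b).not_gt (has i his)
      let d : L → X := fun _ => Classical.arbitrary X
      refine ⟨fun x => g (Function.extend e x d),
        ⟨(insert a s).preimage e he.injective.injOn, fun x y hxy => hs fun i hi => ?_⟩,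
        Eventually.of_forall fun x => hs fun i hi => ?_⟩
      · obtain ⟨k, rfl⟩ := hsub i hi
        rw [he.injective.extend_apply, he.injective.extend_apply]
        exact hxy k (by simpa using hi)
      · obtain ⟨k, rfl⟩ := hsub i hi
        rw [he.injective.extend_apply]
        rfl
    · obtain ⟨t, ht⟩ := hKs
      have hst : ∀ i ∈ s ∪ t.image e, i < a := by
        intro i hi
        rcases Finset.mem_union.1 hi with hi | hi
        · exact has i hi
        · obtain ⟨b, -, rfl⟩ := Finset.mem_image.1 hi
          exact hlow a ha b
      have hKx : ∀ x y : L → X, (∀ i ∈ t.image e, x i = y i) → K (x ∘ e) = K (y ∘ e) :=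
        fun x y hxy => ht fun i hi => hxy _ (Finset.mem_image_of_mem e hi)
      have h1 : ∀ᶠ x in iterFilter U, ∀ᶠ z in (U a).1,
          g (Function.update x a z) ∈ K (Function.update x a z ∘ e) := by
        refine eventually_update (P := fun x => g x ∈ K (x ∘ e)) hst (fun x y hxy => ?_) hg
        dsimp only
        rw [hs (x := x) (y := y) fun i hi => hxy i (by
              simp only [Finset.coe_insert, Finset.coe_union, mem_insert_iff] at hi ⊢
              exact hi.imp id Or.inl),
          hKx x y fun i hi => hxy i (by
              simp only [Finset.coe_insert, Finset.coe_union, mem_insert_iff]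
              exact .inr (.inr hi))]
      have hKu : ∀ x z, K (Function.update x a z ∘ e) = K (x ∘ e) := by
        intro x z
        refine hKx _ _ fun i hi => Function.update_of_ne ?_ _ _
        exact (hst i (Finset.mem_union_right _ hi)).ne
      -- `g₁` is the value that `g` takes for almost every choice of coordinate `a`. It exists
      -- because the small set `K (x ∘ e)` does not change with that coordinate.
      let g₁ : (L → X) → A := fun x =>
        Classical.epsilon fun b => ∀ᶠ z in (U a).1, g (Function.update x a z) = b
      have hg₁ : DependsOn g₁ (s : Set L) := by
        intro x y hxy
        have : ∀ z, g (Function.update x a z) = g (Function.update y a z) := fun z =>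
          hs fun i hi => by
            rcases Finset.mem_insert.1 hi with rfl | hi
            · simp
            · simp [Function.update_of_ne (has i hi).ne, hxy i hi]
        simp only [g₁, this]
      have h2 : ∀ᶠ x in iterFilter U, g x = g₁ x := by
        refine eventually_of_update (P := fun x => g x = g₁ x) (s := s) has
          (fun x y hxy => ?_) ?_
        · dsimp only
          rw [hs hxy, hg₁ fun i hi => hxy i (by simp_all)]
        · filter_upwards [h1] with x hx
          simp only [hKu] at hx
          have := hc a ha
          have hex := (U a).1.eventually_eq_of_smallSet (hK (x ∘ e)) hx
          filter_upwards [Classical.epsilon_spec hex] with z hz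
          rw [hz, hg₁ (x := Function.update x a z) (y := x) fun i hi =>
            Function.update_of_ne (has i hi).ne _ _]
      obtain ⟨g', hg', hg'e⟩ := ih (g := g₁) (by
        filter_upwards [hg, h2] with x h3 h4 using h4 ▸ h3) hg₁
      exact ⟨g', hg', by filter_upwards [h2, hg'e] with x h3 h4 using h3.trans h4⟩

variable [WellFoundedLT L₁]

/-- Stages after `L₁` are `c`-complete, so they add no new members to sets of size less than `c`.
The class `T` is closed under elements, which keeps the induction among such sets. -/
theorem collapse_pull {e : L₁ → L} (he : StrictMono e)
    (hlow : ∀ i ∉ range e, ∀ a, e a < i) {c : Cardinal.{u}}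
    (hc : ∀ i ∉ range e, CardinalInterFilter ((U i).1 : Filter X) c)
    {U₁ : L₁ → CUltrafilter X} (hU : ∀ a, U (e a) = U₁ a)
    {T : Set ZFSet.{u}} (hT : ∀ t ∈ T, ∀ s ∈ t, s ∈ T) (hT0 : ∅ ∈ T)
    (hTc : ∀ t ∈ T, SmallSet c {s | s ∈ t}) {F : (L₁ → X) → ZFSet.{u}} (hFs : FinSupp F)
    (hF : ∀ x, F x ∈ T) : collapse U (fun x => F (x ∘ e)) = collapse U₁ F := by
  classical
  induction F using (wellFounded_uMem U₁).induction with
  | _ F ih =>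
    ext y
    constructor
    · intro hy
      obtain ⟨G, hG, -, hGF, rfl⟩ := mem_collapse.1 hy
      obtain ⟨g, hg, hgG⟩ := exists_eventually_eq_pull (U := U) (K := fun x => {s | s ∈ F x})
        he hlow hc (hFs.comp fun t => {s | s ∈ t}) (fun x => hTc _ (hF x)) hG hGF
      have hg' : FinSupp fun x => if g x ∈ F x then g x else ∅ :=
        hg.comp₂ hFs fun a b => if a ∈ b then a else ∅
      have hgF : ∀ᶠ x in iterFilter U₁, g x ∈ F x := by
        refine (FinSupp.eventually_pull_iff (P := fun x => g x ∈ F x) he hU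
          (hg.comp₂ hFs (· ∈ ·))).1 ?_
        filter_upwards [hGF, hgG] with x h1 h2 using h2 ▸ h1
      have hmem : ∀ᶠ x in iterFilter U₁, (if g x ∈ F x then g x else ∅) ∈ F x := by
        filter_upwards [hgF] with x hx
        rwa [if_pos hx]
      have hIH := ih _ ⟨hg', hmem⟩ hg' fun x => by
        split_ifs with h
        · exact hT _ (hF x) _ h
        · exact hT0
      have hGe : collapse U G =
          collapse U fun x => if g (x ∘ e) ∈ F (x ∘ e) then g (x ∘ e) else ∅ := by
        refine collapse_congr ?_ hG (hg'.pull e)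
        filter_upwards [hGF, hgG] with x h1 h2
        rw [← h2, if_pos h1]
      rw [hGe, hIH]
      exact collapse_mem_of hFs hg' hmem
    · intro hy
      obtain ⟨G, hG, hG', hGF, rfl⟩ := mem_collapse.1 hy
      rw [← ih G ⟨hG, hGF⟩ hG fun x => by
        rcases ZFSet.mem_insert_iff.1 (hG' x) with h | h
        · exact h ▸ hT0
        · exact hT _ (hF x) _ h]
      exact collapse_mem_of (hFs.pull e) (hG.pull e) ((tendsto_pull he hU).eventually hGF)

theorem smallSet_toZFSet {c : Cardinal.{u}} {θ : Ordinal.{u}} (h : θ < c.ord) :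
    SmallSet c {s | s ∈ θ.toZFSet} := by
  refine ⟨θ.ToType, fun i => (Ordinal.ToType.toOrd i).1.toZFSet, ?_, fun s hs => ?_⟩
  · rw [mk_toType]
    exact lt_ord.1 h
  · obtain ⟨a, ha, rfl⟩ := Ordinal.mem_toZFSet_iff.1 hs
    exact ⟨Ordinal.ToType.mk ⟨a, ha⟩, by simp⟩

theorem ocollapse_pull {e : L₁ → L} (he : StrictMono e)
    (hlow : ∀ i ∉ range e, ∀ a, e a < i) {c : Cardinal.{u}}
    (hc : ∀ i ∉ range e, CardinalInterFilter ((U i).1 : Filter X) c)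
    {U₁ : L₁ → CUltrafilter X} (hU : ∀ a, U (e a) = U₁ a)
    {h : (L₁ → X) → Ordinal.{u}} (hhs : FinSupp h) (hh : ∀ x, h x < c.ord) :
    ocollapse U (fun x => h (x ∘ e)) = ocollapse U₁ h := by
  have h0 : 0 < c.ord := pos_of_gt (hh fun _ => Classical.arbitrary X)
  rw [ocollapse, ocollapse, collapse_pull (F := fun x => (h x).toZFSet) he hlow hc hU
    (T := Ordinal.toZFSet '' Iio c.ord) ?_ ⟨0, h0, Ordinal.toZFSet_zero⟩ ?_ (hhs.comp _)
    fun x => ⟨h x, hh x, rfl⟩]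
  · rintro _ ⟨a, ha, rfl⟩ s hs
    obtain ⟨b, hb, rfl⟩ := Ordinal.mem_toZFSet_iff.1 hs
    exact ⟨b, hb.trans ha, rfl⟩
  · rintro _ ⟨a, ha, rfl⟩
    exact smallSet_toZFSet ha

/-- Below `c` the image of `y` is settled by the stages in `L₁`: an ordinal there is represented by
a function on plays on `L₁`, and later coordinates are irrelevant for it. -/
theorem toZFSet_mem_emb_pull {e : L₁ → L} (he : StrictMono e)
    (hlow : ∀ i ∉ range e, ∀ a, e a < i) {c : Cardinal.{u}}
    (hc : ∀ i ∉ range e, CardinalInterFilter ((U i).1 : Filter X) c)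
    {U₁ : L₁ → CUltrafilter X} (hU : ∀ a, U (e a) = U₁ a) (y : ZFSet.{u})
    {θ : Ordinal.{u}} (hθ : θ < c.ord) : θ.toZFSet ∈ emb U y ↔ θ.toZFSet ∈ emb U₁ y := by
  obtain ⟨h, hhs, hh, rfl⟩ := exists_ocollapse_of_lt (U := U₁) hθ
  rw [toZFSet_ocollapse_mem_emb hhs, ← ocollapse_pull he hlow hc hU hhs hh,
    toZFSet_ocollapse_mem_emb (hhs.pull e)]
  exact FinSupp.eventually_pull_iff (P := fun x => (h x).toZFSet ∈ y) he hU
    (hhs.comp fun o => o.toZFSet ∈ y)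

/-- A set that is hereditarily small is not moved. -/
theorem emb_eq_self_of_small {c : Cardinal.{u}}
    (hc : ∀ i, CardinalInterFilter ((U i).1 : Filter X) c)
    {T : Set ZFSet.{u}} (hT : ∀ t ∈ T, ∀ s ∈ t, s ∈ T)
    (hTc : ∀ t ∈ T, SmallSet c {s | s ∈ t}) {p : ZFSet.{u}} (hp : p ∈ T) : emb U p = p := by
  induction p using ZFSet.inductionOn with
  | _ p ih =>
    ext y
    constructor
    · intro hy
      obtain ⟨G, hG, -, hGp, rfl⟩ := mem_collapse.1 hy
      obtain ⟨τ, φ, hτ, hφ⟩ := hTc p hp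
      have := iterFilter_cardinalInter hc
      -- By completeness, a function with values in a small set is constant almost everywhere.
      have hex : ∃ t, ∀ᶠ x in iterFilter U, G x = φ t := by
        by_contra hcon
        have h1 : ∀ᶠ x in iterFilter U, ∀ t, ¬ G x = φ t :=
          (eventually_cardinal_forall hτ).2 fun t =>
            (hG.comp (· = φ t)).eventually_not.2 fun h => hcon ⟨t, h⟩
        obtain ⟨x, h2, h3⟩ := (h1.and hGp).exists
        obtain ⟨t, ht⟩ := hφ h3
        exact h2 t ht.symm
      obtain ⟨t, ht⟩ := hex
      obtain ⟨x, h2, h3⟩ := (ht.and hGp).exists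
      rw [collapse_congr (F' := fun _ => φ t) ht hG (.const _)]
      rw [h2] at h3
      have := ih (φ t) h3 (hT p hp _ h3)
      rw [emb] at this
      rwa [this]
    · intro hy
      rw [← ih y hy (hT p hp y hy)]
      exact collapse_mem_of (.const p) (.const y) (Eventually.of_forall fun _ => hy)

end EndExtension

/-! ### Cardinality of ordinals in the iterated ultrapower -/

section CardBound

variable {L X : Type u} [LinearOrder L] {U : L → CUltrafilter X}

theorem eventually_coord {Y : Set X} {i : L} (hY : Y ∈ (U i).1) :
    ∀ᶠ x in iterFilter U, x i ∈ Y := by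
  refine eventually_of_update (a := i) (s := ∅) (by simp) (P := fun x => x i ∈ Y)
    (fun x y h => ?_) (Eventually.of_forall fun x => ?_)
  · dsimp only
    rw [h i (by simp)]
  · filter_upwards [hY] with z hz
    simpa using hz

variable [Nonempty X]

/-- Up to equality almost everywhere, a function of finite support is given by finitely many
coordinates and a function on a finite power of a given large set. -/
theorem exists_eq_of_large {A : Type*} {Y : Set X} {F : (L → X) → A}
    {s : Finset L} (hs : DependsOn F (s : Set L)) (hY : ∀ i ∈ s, Y ∈ (U i).1) :
    ∃ (n : ℕ) (e : Fin n → L) (g : (Fin n → Y) → A), (∀ k, ∃ x, g k = F x) ∧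
      ∀ᶠ x in iterFilter U, ∃ k : Fin n → Y, (∀ m, x (e m) = (k m : X)) ∧ F x = g k := by
  let e : Fin s.card → L := fun m => s.orderEmbOfFin rfl m
  have he : Function.Injective e := (s.orderEmbOfFin rfl).injective
  have hrange : ∀ i ∈ s, ∃ m, e m = i := by
    intro i hi
    have : i ∈ range (s.orderEmbOfFin rfl) := by rw [Finset.range_orderEmbOfFin]; exact hi
    exact this
  let d : L → X := fun _ => Classical.arbitrary X
  refine ⟨s.card, e, fun k => F (Function.extend e (fun m => (k m : X)) d), fun k => ⟨_, rfl⟩, ?_⟩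
  filter_upwards [eventually_all.2 fun m =>
    eventually_coord (U := U) (hY (e m) (s.orderEmbOfFin_mem rfl m))] with x hx
  refine ⟨fun m => ⟨x (e m), hx m⟩, fun m => rfl, hs fun i hi => ?_⟩
  obtain ⟨m, rfl⟩ := hrange i hi
  rw [he.extend_apply]

variable [WellFoundedLT L]

theorem card_oemb_le {ν : Cardinal.{u}} (hν : ℵ₀ ≤ ν) (hL : #L ≤ 2 ^ ν) {Y : Set X}
    (hY : ∀ i, Y ∈ (U i).1) (hYν : #Y ≤ ν) {θ : Ordinal.{u}} (hθ : θ.card ≤ 2 ^ ν) :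
    (oemb U θ).card ≤ 2 ^ ν := by
  classical
  rcases eq_or_ne θ 0 with rfl | hθ0
  · have : oemb U 0 = 0 := by
      by_contra h0
      obtain ⟨g, -, -, hg, -⟩ := exists_ocollapse_eq (U := U) (.const 0)
        (pos_iff_ne_zero.2 h0)
      obtain ⟨x, hx⟩ := hg.exists
      exact not_lt_zero hx
    simp [this]
  let val : θ.ToType → Ordinal.{u} := fun t => (Ordinal.ToType.toOrd t).1
  -- Ordinals below the image of `θ` are coded by finitely many coordinates and a function from a
  -- finite power of `Y` to `θ`. There are at most ℵ₀ · 2^ν · (2^ν)^ν = 2^ν codes.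
  let I : Type u := Σ n : ℕ, (Fin n → L) × ((Fin n → Y) → θ.ToType)
  let Φ : I → Ordinal.{u} := fun p => ocollapse U fun x =>
    if h : ∃ k : Fin p.1 → Y, ∀ m, x (p.2.1 m) = (k m : X) then val (p.2.2 h.choose) else 0
  have hsurj : ∀ η < oemb U θ, ∃ p, Φ p = η := by
    intro η hη
    obtain ⟨g, hg, hgθ', hgθ, rfl⟩ := exists_ocollapse_eq (.const θ) hη
    have hgθ : ∀ x, g x < θ := fun x =>
      (hgθ' x).elim id fun h => h ▸ pos_iff_ne_zero.2 hθ0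
    obtain ⟨s, hs⟩ := id hg
    obtain ⟨n, e, g', hg', hgg⟩ := exists_eq_of_large hs fun i _ => hY i
    have hg'θ : ∀ k, g' k < θ := fun k => by
      obtain ⟨x, hx⟩ := hg' k
      exact hx ▸ hgθ x
    refine ⟨⟨n, e, fun k => Ordinal.ToType.mk ⟨g' k, hg'θ k⟩⟩, ?_⟩
    have hsupp : FinSupp fun x : L → X => if h : ∃ k : Fin n → Y, ∀ m, x (e m) = (k m : X) then
        val ((fun k => Ordinal.ToType.mk ⟨g' k, hg'θ k⟩) h.choose) else 0 :=
      (FinSupp.pi fun m => FinSupp.coord (e m)).comp fun w : Fin n → X =>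
        if h : ∃ k : Fin n → Y, ∀ m, w m = (k m : X) then
          val ((fun k => Ordinal.ToType.mk ⟨g' k, hg'θ k⟩) h.choose) else 0
    refine (ocollapse_eq_iff hsupp hg).2 ?_
    filter_upwards [hgg] with x hx
    obtain ⟨k, hk, hgk⟩ := hx
    have hex : ∃ k : Fin n → Y, ∀ m, x (e m) = (k m : X) := ⟨k, hk⟩
    rw [dif_pos hex]
    have hch : hex.choose = k := funext fun m =>
      Subtype.ext ((hex.choose_spec m).symm.trans (hk m))
    rw [hch, hgk]
    simp [val]
  have hI : #I ≤ 2 ^ ν := by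
    have hν2 : ℵ₀ ≤ (2 : Cardinal.{u}) ^ ν := hν.trans (cantor ν).le
    have h1 : ∀ n : ℕ, #((Fin n → L) × ((Fin n → Y) → θ.ToType)) ≤ 2 ^ ν := by
      intro n
      have ha : #(Fin n → L) ≤ 2 ^ ν := by
        rw [mk_pi, prod_const]
        simp only [mk_fin, lift_natCast, lift_uzero]
        exact (power_le_power_right hL).trans (by exact_mod_cast power_nat_le hν2)
      have hb : #(Fin n → Y) ≤ ν := by
        rw [mk_pi, prod_const]
        simp only [mk_fin, lift_natCast, lift_uzero]
        exact (power_le_power_right hYν).trans (by exact_mod_cast power_nat_le hν)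
      have hb' : #((Fin n → Y) → θ.ToType) ≤ 2 ^ ν := by
        rw [← power_def, mk_toType]
        refine (power_le_power_right hθ).trans ?_
        rw [← power_mul]
        exact power_le_power_left two_ne_zero
          ((mul_le_mul_right hb ν).trans (mul_eq_self hν).le)
      rw [mk_prod, lift_id, lift_id]
      exact (mul_le_mul' ha hb').trans (mul_eq_self hν2).le
    rw [mk_sigma]
    refine (sum_le_sum _ (fun _ => 2 ^ ν) h1).trans ?_
    rw [sum_const]
    simp only [mk_nat, lift_aleph0, lift_id']
    exact (mul_le_mul' hν2 le_rfl).trans (mul_eq_self hν2).le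
  have h2 : lift.{u + 1} (oemb U θ).card ≤ lift.{u + 1} #I := by
    rw [← mk_Iio_ordinal]
    have : Iio (oemb U θ) ⊆ range Φ := fun η hη => hsurj η hη
    refine (mk_le_mk_of_subset this).trans ?_
    have := mk_range_le_lift (f := Φ)
    rw [lift_id'.{u, u+1}] at this
    exact this
  exact (lift_le.1 h2).trans hI

/-- The successor of a power of two is not reached by small iterations. -/
theorem ocollapse_lt_succ {ν : Cardinal.{u}} (hν : ℵ₀ ≤ ν) (hL : #L ≤ 2 ^ ν) {Y : Set X}
    (hY : ∀ i, Y ∈ (U i).1) (hYν : #Y ≤ ν) {h : (L → X) → Ordinal.{u}} (hhs : FinSupp h)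
    (hh : ∀ x, h x < (Order.succ ((2 : Cardinal.{u}) ^ ν)).ord) :
    ocollapse U h < (Order.succ ((2 : Cardinal.{u}) ^ ν)).ord := by
  have hν2 : ℵ₀ ≤ (2 : Cardinal.{u}) ^ ν := hν.trans (cantor ν).le
  obtain ⟨s, hs⟩ := id hhs
  obtain ⟨n, e, g, hg, hgh⟩ := exists_eq_of_large hs fun i _ => hY i
  have hb : #(Fin n → Y) ≤ ν := by
    rw [mk_pi, prod_const]
    simp only [mk_fin, lift_natCast, lift_uzero]
    exact (power_le_power_right hYν).trans (by exact_mod_cast power_nat_le hν)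
  -- The values that matter are indexed by a finite power of `Y`, hence by at most `ν` points, and
  -- (2^ν)⁺ is regular.
  have hsup : ⨆ k, g k < (Order.succ ((2 : Cardinal.{u}) ^ ν)).ord := by
    refine Ordinal.iSup_lt_of_lt_cof ?_ fun k => ?_
    · rw [(isRegular_succ hν2).cof_ord]
      exact hb.trans_lt ((cantor ν).trans (Order.lt_succ _))
    · obtain ⟨x, hx⟩ := hg k
      exact hx ▸ hh x
  have h1 : ocollapse U h ≤ oemb U (⨆ k, g k) := by
    refine le_of_not_gt fun hlt => ?_
    obtain ⟨x, hx, k, -, hk⟩ := (((ocollapse_lt_iff (.const _) hhs).1 hlt).and hgh).exists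
    rw [hk] at hx
    exact hx.not_ge (Ordinal.le_iSup g k)
  refine h1.trans_lt (lt_ord.2 (Order.lt_succ_iff.2 ?_))
  exact card_oemb_le hν hL hY hYν (Order.lt_succ_iff.1 (lt_ord.1 hsup))

end CardBound

/-! ### Composition of iterations -/

section Comp

variable {E Q N K X : Type u} [LinearOrder E] [LinearOrder Q] [LinearOrder N] [Nonempty X]
  {e₁ : E → N} {e₂ : Q → N} {A : Type*}

/-- The function on plays on `K` that arises from a function on plays on `N` and a play on `E`,
if a play on `E` determines a map from `Q` to `K`. -/
noncomputable def slice (e₁ : E → N) (e₂ : Q → N) (h : Q → (E → X) → K) (G : (N → X) → A)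
    (x : E → X) : (K → X) → A :=
  fun z => G (join e₁ e₂ x fun q => z (h q x))

theorem FinSupp.slice (hc : IsConcat e₁ e₂) {h : Q → (E → X) → K} (hh : ∀ q, FinSupp (h q))
    {G : (N → X) → A} (hG : FinSupp G) : FinSupp (slice e₁ e₂ h G) := by
  classical
  obtain ⟨s, hs⟩ := hG
  choose t ht using hh
  refine ⟨s.preimage e₁ hc.mono₁.injective.injOn ∪
    (s.preimage e₂ hc.mono₂.injective.injOn).biUnion t, fun x y hxy => funext fun z => hs ?_⟩
  intro n hn
  rcases hc.cover n with ⟨a, rfl⟩ | ⟨q, rfl⟩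
  · rw [join_left hc, join_left hc]
    exact hxy a (by
      rw [Finset.mem_coe, Finset.mem_union, Finset.mem_preimage]
      exact .inl hn)
  · rw [join_right hc, join_right hc, ht q fun i hi => hxy i ?_]
    rw [Finset.mem_coe, Finset.mem_union, Finset.mem_biUnion]
    exact .inr ⟨q, Finset.mem_preimage.2 hn, hi⟩

theorem FinSupp.slice_apply (hc : IsConcat e₁ e₂) (h : Q → (E → X) → K)
    {G : (N → X) → A} (hG : FinSupp G) (x : E → X) :
    FinSupp (IteratedUltrapower.slice e₁ e₂ h G x) := by
  classical
  obtain ⟨s, hs⟩ := hG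
  refine ⟨(s.preimage e₂ hc.mono₂.injective.injOn).image fun q => h q x,
    fun z z' hz => hs fun n hn => ?_⟩
  rcases hc.cover n with ⟨a, rfl⟩ | ⟨q, rfl⟩
  · rw [join_left hc, join_left hc]
  · rw [join_right hc, join_right hc]
    exact hz _ (Finset.mem_coe.2 (Finset.mem_image.2 ⟨q, Finset.mem_preimage.2 hn, rfl⟩))

variable [LinearOrder K] [WellFoundedLT Q]
  {U : N → CUltrafilter X} {V : CUltrafilter X}

theorem eventually_slice_of (hc : IsConcat e₁ e₂) (hV : ∀ q, U (e₂ q) = V)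
    {h : Q → (E → X) → K}
    (hmono : ∀ q q', q < q' → ∀ᶠ x in iterFilter fun a => U (e₁ a), h q x < h q' x)
    {P : (N → X) → Prop} (hP : FinSupp P) (hw : ∀ᶠ w in iterFilter U, P w) :
    ∀ᶠ x in iterFilter fun a => U (e₁ a), ∀ᶠ z in iterFilter fun _ : K => V,
      slice e₁ e₂ h P x z := by
  classical
  obtain ⟨s, hs⟩ := hP
  let t : Finset Q := s.preimage e₂ hc.mono₂.injective.injOn
  -- Each comparison holds for almost all `x`. Only the finitely many indices in the support of `P`
  -- are needed, so all relevant comparisons hold together.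
  have hm : ∀ᶠ x in iterFilter fun a => U (e₁ a), ∀ q q' : t, q < q' → h q x < h q' x := by
    refine eventually_all.2 fun q => eventually_all.2 fun q' => ?_
    by_cases hq : q < q'
    · filter_upwards [hmono q q' hq] with x hx _ using hx
    · exact Eventually.of_forall fun x h' => absurd h' hq
  filter_upwards [hm, eventually_join hc hw] with x hx hxz
  let d : Q → X := fun _ => Classical.arbitrary X
  let R : (t → X) → Prop := fun y => P (join e₁ e₂ x (Function.extend Subtype.val y d))
  have hR : ∀ (z : Q → X) (y : t → X), (∀ q : t, z q = y q) → (P (join e₁ e₂ x z) = R y) := by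
    intro z y hzy
    refine hs fun n hn => ?_
    rcases hc.cover n with ⟨a, rfl⟩ | ⟨q, rfl⟩
    · rw [join_left hc, join_left hc]
    · rw [join_right hc, join_right hc]
      have hq : q ∈ t := Finset.mem_preimage.2 hn
      have := Subtype.val_injective.extend_apply y d ⟨q, hq⟩
      rw [this]
      exact hzy ⟨q, hq⟩
  have hRs : FinSupp R := ⟨Finset.univ, fun y y' hy => by
    have : y = y' := funext fun q => hy q (by simp)
    rw [this]⟩
  -- The event passes from plays on `Q` to plays on the finite order `t`, and from there to plays on
  -- `K` along the order embedding given by `x`; all these stages use the same ultrafilter `V`.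
  have h1 : ∀ᶠ y in iterFilter fun _ : t => V, R y := by
    refine (FinSupp.eventually_pull_iff (U' := fun q => U (e₂ q)) (e := (Subtype.val : t → Q))
      (fun _ _ h => h) (fun q => hV q) hRs).1 ?_
    filter_upwards [hxz] with z hz
    exact (hR z _ fun q => rfl).mp hz
  have h2 := (tendsto_pull (U := fun _ : t => V) (U' := fun _ : K => V)
    (e := fun q : t => h q x) (fun q q' hq => hx q q' hq) fun _ => rfl).eventually h1
  filter_upwards [h2] with z hz
  exact (hR (fun q => z (h q x)) _ fun q => rfl).mpr hz

variable [WellFoundedLT E] [WellFoundedLT K]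

theorem eventually_slice_iff (hc : IsConcat e₁ e₂) (hV : ∀ q, U (e₂ q) = V)
    {h : Q → (E → X) → K}
    (hmono : ∀ q q', q < q' → ∀ᶠ x in iterFilter fun a => U (e₁ a), h q x < h q' x)
    {P : (N → X) → Prop} (hP : FinSupp P) :
    (∀ᶠ w in iterFilter U, P w) ↔
    ∀ᶠ x in iterFilter fun a => U (e₁ a), ∀ᶠ z in iterFilter fun _ : K => V,
      slice e₁ e₂ h P x z := by
  refine ⟨eventually_slice_of hc hV hmono hP, fun hx => ?_⟩
  refine hP.eventually_or_not.resolve_right fun hn => ?_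
  have h2 := eventually_slice_of hc hV hmono (hP.comp Not) hn
  obtain ⟨x, h3, h4⟩ := (hx.and h2).exists
  obtain ⟨z, h5, h6⟩ := (h3.and h4).exists
  exact h6 h5

variable [WellFoundedLT N]

/-- An iteration by one ultrafilter along `K`, formed inside the iterated ultrapower along `E`,
amounts to the iteration along the concatenation of `E` and the image `Q` of `K`. -/
theorem collapse_slice [Nonempty K] (hc : IsConcat e₁ e₂) (hV : ∀ q, U (e₂ q) = V)
    {h : Q → (E → X) → K} (hhs : ∀ q, FinSupp (h q))
    (hmono : ∀ q q', q < q' → ∀ᶠ x in iterFilter fun a => U (e₁ a), h q x < h q' x)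
    (hsurj : ∀ u : (E → X) → K, FinSupp u →
      ∃ q, ∀ᶠ x in iterFilter fun a => U (e₁ a), u x = h q x)
    {G : (N → X) → ZFSet.{u}} (hG : FinSupp G) :
    collapse U G = collapse (fun a => U (e₁ a)) fun x =>
      collapse (fun _ : K => V) (slice e₁ e₂ h G x) := by
  classical
  have hcs : ∀ {G : (N → X) → ZFSet.{u}}, FinSupp G →
      FinSupp fun x => collapse (fun _ : K => V) (slice e₁ e₂ h G x) :=
    fun hG => (hG.slice hc hhs).comp _
  have hmem : ∀ {H G : (N → X) → ZFSet.{u}}, FinSupp H → FinSupp G →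
      (∀ᶠ w in iterFilter U, H w ∈ G w) →
      ∀ᶠ x in iterFilter fun a => U (e₁ a), collapse (fun _ : K => V) (slice e₁ e₂ h H x) ∈
        collapse (fun _ : K => V) (slice e₁ e₂ h G x) := by
    intro H G hH hG hHG
    filter_upwards [eventually_slice_of hc hV hmono (hH.comp₂ hG (· ∈ ·)) hHG] with x hx
    exact collapse_mem_of (hG.slice_apply hc h x) (hH.slice_apply hc h x) hx
  induction G using (wellFounded_uMem U).induction with
  | _ G ih =>
    ext y
    constructor
    · intro hy
      obtain ⟨H, hH, -, hHG, rfl⟩ := mem_collapse.1 hy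
      rw [ih H ⟨hH, hHG⟩ hH]
      exact collapse_mem_of (hcs hG) (hcs hH) (hmem hH hG hHG)
    · intro hy
      obtain ⟨f, hf, -, hfG, rfl⟩ := mem_collapse.1 hy
      have hch : ∀ (a : ZFSet.{u}) (g : (K → X) → ZFSet.{u}), ∃ (p : (K → X) → ZFSet.{u})
          (σ : Finset K), DependsOn p (σ : Set K) ∧ (a ∈ collapse (fun _ : K => V) g →
            (∀ᶠ z in iterFilter fun _ : K => V, p z ∈ g z) ∧
              collapse (fun _ : K => V) p = a) := by
        intro a g
        by_cases ha : a ∈ collapse (fun _ : K => V) g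
        · obtain ⟨p, ⟨σ, hσ⟩, -, hp, hpa⟩ := mem_collapse.1 ha
          exact ⟨p, σ, hσ, fun _ => ⟨hp, hpa⟩⟩
        · exact ⟨fun _ => ∅, ∅, fun _ _ _ => rfl, fun h' => absurd h' ha⟩
      choose p σ hpσ hp using hch
      let d : K := Classical.arbitrary K
      have hpair : FinSupp fun x => (f x, slice e₁ e₂ h G x) := hf.pair (hG.slice hc hhs)
      -- The size of the inner support varies with `x`, but countable completeness makes it constant
      -- almost everywhere.
      have hcard : ∃ n : ℕ, ∀ᶠ x in iterFilter fun a => U (e₁ a),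
          (σ (f x) (slice e₁ e₂ h G x)).card = n := by
        by_contra hcon
        have h1 : ∀ᶠ x in iterFilter fun a => U (e₁ a), ∀ n : ℕ,
            ¬ (σ (f x) (slice e₁ e₂ h G x)).card = n :=
          eventually_countable_forall.2 fun n =>
            (hpair.comp fun r => (σ r.1 r.2).card = n).eventually_not.2 fun h' => hcon ⟨n, h'⟩
        obtain ⟨x, hx⟩ := h1.exists
        exact hx _ rfl
      obtain ⟨n, hn⟩ := hcard
      -- The inner support is listed by `n` functions into `K`; each agrees almost everywhere with
      -- some `h (q m)`, which turns inner coordinates into actual coordinates in `Q`.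
      let u : Fin n → (E → X) → K := fun m x =>
        (σ (f x) (slice e₁ e₂ h G x)).toList.getD m d
      have hu : ∀ m, FinSupp (u m) := fun m => hpair.comp fun r => (σ r.1 r.2).toList.getD m d
      choose q hq using fun m => hsurj (u m) (hu m)
      let H : (N → X) → ZFSet.{u} := fun w =>
        p (f (w ∘ e₁)) (slice e₁ e₂ h G (w ∘ e₁)) fun k =>
          if hk : ∃ m, u m (w ∘ e₁) = k then w (e₂ (q hk.choose)) else Classical.arbitrary X
      have hH : FinSupp H := by
        have h1 : FinSupp fun w : N → X =>
            ((f (w ∘ e₁), slice e₁ e₂ h G (w ∘ e₁)), fun m => w (e₂ (q m))) :=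
          (hpair.pull e₁).pair (FinSupp.pi fun m => FinSupp.coord (e₂ (q m)))
        exact h1.comp fun r => p r.1.1 r.1.2 fun k =>
          if hk : ∃ m : Fin n, (σ r.1.1 r.1.2).toList.getD m d = k then r.2 hk.choose
            else Classical.arbitrary X
      have hHx : ∀ᶠ x in iterFilter fun a => U (e₁ a),
          slice e₁ e₂ h H x = p (f x) (slice e₁ e₂ h G x) := by
        filter_upwards [hn, eventually_all.2 hq] with x hxn hxq
        funext z
        have hj : (join e₁ e₂ x fun q => z (h q x)) ∘ e₁ = x :=
          funext fun a => join_left hc _ _ a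
        simp only [slice, H]
        rw [hj]
        refine hpσ _ _ fun k hk => ?_
        have hex : ∃ m, u m x = k := by
          obtain ⟨m, hm, hmk⟩ := List.getElem_of_mem (Finset.mem_toList.2 hk)
          have hm' : m < n := by rwa [Finset.length_toList, hxn] at hm
          exact ⟨⟨m, hm'⟩, by simp only [u]; rw [List.getD_eq_getElem _ _ hm, hmk]⟩
        rw [dif_pos hex, join_right hc, ← hxq, hex.choose_spec]
      have hHG : ∀ᶠ w in iterFilter U, H w ∈ G w := by
        refine (eventually_slice_iff hc hV hmono (hH.comp₂ hG (· ∈ ·))).2 ?_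
        filter_upwards [hHx, hfG] with x hx hx'
        filter_upwards [(hp _ _ hx').1] with z hz
        have := congrFun hx z
        simp only [slice] at this hz ⊢
        rwa [this]
      have hHf : collapse U H = collapse (fun a => U (e₁ a)) f := by
        rw [ih H ⟨hH, hHG⟩ hH]
        refine collapse_congr ?_ (hcs hH) hf
        filter_upwards [hHx, hfG] with x hx hx'
        rw [hx]
        exact (hp _ _ hx').2
      rw [← hHf]
      exact collapse_mem_of hG hH hHG

/-- The iteration of length `(2 ^ ν)⁺` commutes with small iterations. -/
theorem emb_emb_succ {ν : Cardinal.{u}} (hν : ℵ₀ ≤ ν) {e₁ : E → N}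
    {e₂ : (Order.succ ((2 : Cardinal.{u}) ^ ν)).ord.ToType → N} (hc : IsConcat e₁ e₂)
    (hE : #E ≤ 2 ^ ν) {Y : Set X} (hY : ∀ a, Y ∈ (U (e₁ a)).1) (hYν : #Y ≤ ν)
    (hV : ∀ q, U (e₂ q) = V) (y : ZFSet.{u}) :
    emb (fun a => U (e₁ a))
      (emb (fun _ : (Order.succ ((2 : Cardinal.{u}) ^ ν)).ord.ToType => V) y) = emb U y := by
  set β := (Order.succ ((2 : Cardinal.{u}) ^ ν)).ord with hβ
  have hβ0 : β ≠ 0 := by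
    rw [hβ, Ne, ord_eq_zero]
    exact (Order.succ_ne_bot _)
  have : Nonempty β.ToType := Ordinal.nonempty_toType_iff.2 hβ0
  -- Each `q < β` is represented by a function into `β` on plays on `E`. Conversely such functions
  -- represent only ordinals below `β`, by `ocollapse_lt_succ`, so `β` is its own image and serves
  -- both as inner and as outer length.
  have hex : ∀ q : β.ToType, ∃ g : (E → X) → Ordinal.{u}, FinSupp g ∧ (∀ x, g x < β) ∧
      ocollapse (fun a => U (e₁ a)) g = (Ordinal.ToType.toOrd q).1 := fun q =>
    exists_ocollapse_of_lt (Ordinal.ToType.toOrd q).2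
  choose g hgs hgβ hg using hex
  refine (collapse_slice (h := fun q x => Ordinal.ToType.mk ⟨g q x, hgβ q x⟩) hc hV
    (fun q => ?_) (fun q q' hq => ?_) (fun u hu => ?_) (.const y)).symm
  · obtain ⟨s, hs⟩ := hgs q
    exact ⟨s, fun x x' hx => by simp only [hs hx]⟩
  · have h1 : ocollapse (fun a => U (e₁ a)) (g q) < ocollapse (fun a => U (e₁ a)) (g q') := by
      rw [hg, hg, Subtype.coe_lt_coe]
      exact (OrderIso.lt_iff_lt _).2 hq
    filter_upwards [(ocollapse_lt_iff (hgs q) (hgs q')).1 h1] with x hx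
    exact (OrderIso.lt_iff_lt _).2 hx
  · have hus : FinSupp fun x => (Ordinal.ToType.toOrd (u x)).1 :=
      hu.comp fun t => (Ordinal.ToType.toOrd t).1
    have hlt : ocollapse (fun a => U (e₁ a)) (fun x => (Ordinal.ToType.toOrd (u x)).1) < β :=
      ocollapse_lt_succ hν hE hY hYν hus fun x => (Ordinal.ToType.toOrd (u x)).2
    refine ⟨Ordinal.ToType.mk ⟨_, hlt⟩, ?_⟩
    have h1 := hg (Ordinal.ToType.mk ⟨_, hlt⟩)
    simp only [OrderIso.symm_apply_apply] at h1
    filter_upwards [(ocollapse_eq_iff (hgs _) hus).1 h1] with x hx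
    simp only [hx]
    simp

end Comp

/-! ### Elements of ordinals -/

section ToType

variable {o : Ordinal.{u}}

/-- The ordinal of an element of the type of an ordinal. -/
noncomputable def rk (i : o.ToType) : Ordinal.{u} := (Ordinal.ToType.toOrd i).1

/-- The element of the type of an ordinal that is given by a smaller ordinal. -/
noncomputable def elt (a : Ordinal.{u}) (h : a < o) : o.ToType := Ordinal.ToType.mk ⟨a, h⟩

theorem rk_lt (i : o.ToType) : rk i < o := (Ordinal.ToType.toOrd i).2

@[simp] theorem rk_elt {a : Ordinal.{u}} (h : a < o) : rk (elt a h) = a := by simp [rk, elt]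

theorem rk_lt_rk {i k : o.ToType} : rk i < rk k ↔ i < k := by
  rw [rk, rk, Subtype.coe_lt_coe, OrderIso.lt_iff_lt]

theorem rk_le_rk {i k : o.ToType} : rk i ≤ rk k ↔ i ≤ k := by
  rw [← not_lt, rk_lt_rk, not_lt]

theorem rk_injective : Function.Injective (rk : o.ToType → Ordinal.{u}) := fun _ _ h =>
  le_antisymm (rk_le_rk.1 h.le) (rk_le_rk.1 h.ge)

@[simp] theorem elt_rk (i : o.ToType) : elt (rk i) (rk_lt i) = i := rk_injective (by simp)

theorem mk_Iio_ord_lt {c : Cardinal.{u}} (i : c.ord.ToType) : #(Iio i) < c := by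
  have := mk_Iio_lt i (by simp)
  rwa [mk_ord_toType] at this

end ToType

/-! ### Measurable cardinals -/

section Measurable

theorem compl_mem_of_mk_lt {δ : Cardinal.{u}} {α : Type u} {V : Ultrafilter α}
    [CardinalInterFilter (V : Filter α) δ] (hV : ∀ a, {a} ∉ V) {s : Set α} (hs : #s < δ) :
    sᶜ ∈ V := by
  have h : (⋂ a ∈ s, ({a}ᶜ : Set α)) ∈ (V : Filter α) :=
    (cardinal_bInter_mem hs).2 fun a _ => Ultrafilter.compl_mem_iff_notMem.2 (hV a)
  refine mem_of_superset h fun x hx hxs => ?_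
  simp only [mem_iInter] at hx
  exact hx x hxs rfl

theorem isInaccessible_of_isMeasurableCardinal {δ : Cardinal.{u}}
    (h : PerfectSubset.IsMeasurableCardinal δ) : IsInaccessible δ := by
  obtain ⟨hδ, V, hV, hV1⟩ := h
  refine ⟨hδ, le_of_not_gt fun hcof => ?_, fun ν hν => lt_of_not_ge fun hle => ?_⟩
  · rw [← Ordinal.cof_toType] at hcof
    obtain ⟨s, hs, hsc⟩ := Order.exists_cof_eq (α := δ.ord.ToType)
    have h1 : (⋂ b ∈ s, (Iic b)ᶜ) ∈ (V : Filter δ.ord.ToType) := by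
      refine (cardinal_bInter_mem (hsc.trans_lt hcof)).2 fun b _ =>
        compl_mem_of_mk_lt (δ := δ) hV1 ?_
      have : Iic b = insert b (Iio b) := Iio_insert.symm
      rw [this]
      exact mk_insert_le.trans_lt (add_lt_of_lt hδ.le (mk_Iio_ord_lt b)
        (one_lt_aleph0.trans hδ))
    obtain ⟨x, hx⟩ := V.nonempty_of_mem h1
    obtain ⟨b, hb, hxb⟩ := hs x
    simp only [mem_iInter] at hx
    exact hx b hb hxb
  · have hle' : #δ.ord.ToType ≤ #(Set ν.out) := by
      rw [mk_ord_toType, mk_set, mk_out]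
      exact hle
    obtain ⟨f⟩ := Cardinal.le_def _ _ |>.1 hle'
    -- If `δ` injects into the subsets of `ν < δ`, then completeness decides all `ν` coordinates at
    -- once, so the injection is constant on a large set.
    have hall : ∀ᶠ i in (V : Filter δ.ord.ToType), ∀ a : ν.out,
        (a ∈ f i ↔ ∀ᶠ i in (V : Filter δ.ord.ToType), a ∈ f i) := by
      refine (eventually_cardinal_forall (by rwa [mk_out])).2 fun a => ?_
      by_cases ha : ∀ᶠ i in (V : Filter δ.ord.ToType), a ∈ f i
      · filter_upwards [ha] with i hi
        simp [hi, ha]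
      · filter_upwards [Ultrafilter.eventually_not.2 ha] with i hi
        simp [hi, ha]
    obtain ⟨i₀, hi₀⟩ := hall.exists
    refine hV1 i₀ ?_
    filter_upwards [hall] with i hi
    exact f.injective (Set.ext fun a => (hi a).trans (hi₀ a).symm)

theorem mk_rk_lt {κ : Cardinal.{u}} (δ : Cardinal.{u}) :
    #{x : κ.ord.ToType | rk x < δ.ord} ≤ δ := by
  refine (mk_le_of_injective (β := δ.ord.ToType) (f := fun x => elt (rk x.1) x.2)
    fun x y hxy => Subtype.ext (rk_injective ?_)).trans (mk_ord_toType δ).le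
  simpa using congrArg rk hxy

/-- An inaccessible cardinal below `κ` with a complete ultrafilter, transferred to `κ`. -/
structure Label (κ : Cardinal.{u}) where
  card : Cardinal.{u}
  ult : CUltrafilter κ.ord.ToType
  inaccessible : IsInaccessible card
  lt : card < κ
  complete : CardinalInterFilter (ult.1 : Filter κ.ord.ToType) card
  large : {x | rk x < card.ord} ∈ ult.1
  unbounded : ∀ θ < card.ord, {x | θ < rk x} ∈ ult.1

/-- The measure is pushed forward along the inclusion of `δ` in `κ`. All measures then live on one
set and can be mixed in one iteration. -/
theorem exists_label {κ δ : Cardinal.{u}} (h : PerfectSubset.IsMeasurableCardinal δ)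
    (hδκ : δ < κ) : ∃ ℓ : Label κ, ℓ.card = δ := by
  have hin := isInaccessible_of_isMeasurableCardinal h
  obtain ⟨hδ, V, hV, hV1⟩ := h
  have hlt : δ.ord < κ.ord := ord_lt_ord.2 hδκ
  let f : δ.ord.ToType → κ.ord.ToType := fun i => elt (rk i) ((rk_lt i).trans hlt)
  have hf : ∀ i, rk (f i) = rk i := fun i => rk_elt _
  have hc : CardinalInterFilter ((V.map f : Ultrafilter κ.ord.ToType) : Filter κ.ord.ToType) δ := by
    rw [Ultrafilter.coe_map]
    infer_instance
  refine ⟨⟨δ, ⟨V.map f, @CardinalInterFilter.toCountableInterFilter _ _ _ hc hδ⟩, hin, hδκ, hc,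
    ?_, fun θ hθ => ?_⟩, rfl⟩
  · refine Ultrafilter.mem_map.2 (Filter.univ_mem' fun i => ?_)
    simp only [mem_preimage, mem_ofPred_eq, hf]
    exact rk_lt i
  · refine Ultrafilter.mem_map.2 ?_
    have hlim : θ + 1 < δ.ord := (isSuccLimit_ord hδ.le).add_one_lt hθ
    refine mem_of_superset (compl_mem_of_mk_lt hV1
      (mk_Iio_ord_lt (elt (θ + 1) hlim))) fun i hi => ?_
    simp only [mem_preimage, mem_ofPred_eq, hf]
    simp only [mem_compl_iff, mem_Iio, not_lt] at hi
    rw [← rk_le_rk, rk_elt] at hi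
    exact (Order.lt_add_one_iff.2 le_rfl).trans_le hi

end Measurable

/-! ### Iterations by a single ultrafilter -/

section Block

variable {κ : Cardinal.{u}} [Nonempty κ.ord.ToType]

theorem oemb_lt_of_isStrongLimit {L X : Type u} [LinearOrder L] [WellFoundedLT L] [Nonempty X]
    {U : L → CUltrafilter X} {δ : Cardinal.{u}} (hδ : IsStrongPrelimit δ) (hδ0 : ℵ₀ < δ)
    (hL : #L < δ) {Y : Set X} (hY : ∀ i, Y ∈ (U i).1) (hYδ : #Y < δ) {θ : Ordinal.{u}}
    (hθ : θ < δ.ord) : oemb U θ < δ.ord := by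
  set ν := max (max ℵ₀ #L) (max #Y θ.card) with hν
  have hνδ : ν < δ := max_lt (max_lt hδ0 hL) (max_lt hYδ (lt_ord.1 hθ))
  have h2 : ν ≤ 2 ^ ν := (cantor ν).le
  refine lt_ord.2 ((card_oemb_le (ν := ν) ?_ ?_ hY ?_ ?_).trans_lt (hδ hνδ))
  · exact (le_max_left _ _).trans (le_max_left _ _)
  · exact ((le_max_right _ _).trans (le_max_left _ _)).trans h2
  · exact (le_max_left _ _).trans (le_max_right _ _)
  · exact ((le_max_right _ _).trans (le_max_right _ _)).trans h2

/-- A function into `δ` takes almost everywhere fewer than `δ` values, so by regularity it is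
bounded by some ordinal below `δ`, whose image is again below `δ`. -/
theorem oemb_ord_of_isInaccessible {L X : Type u} [LinearOrder L] [WellFoundedLT L] [Nonempty X]
    {U : L → CUltrafilter X} {δ : Cardinal.{u}} (hδ : IsInaccessible δ)
    (hL : #L < δ) {Y : Set X} (hY : ∀ i, Y ∈ (U i).1) (hYδ : #Y < δ) :
    oemb U δ.ord = δ.ord := by
  refine le_antisymm (le_of_not_gt fun hlt => ?_) (le_oemb _)
  obtain ⟨g, hg, hg', -, he⟩ := exists_ocollapse_eq (.const δ.ord) hlt
  have hδ0 : 0 < δ.ord := hδ.isRegular.ord_pos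
  have hgδ : ∀ x, g x < δ.ord := fun x => (hg' x).elim id fun h => h ▸ hδ0
  obtain ⟨s, hs⟩ := id hg
  obtain ⟨n, e, k, hk, hgk⟩ := exists_eq_of_large hs fun i _ => hY i
  have hsup : ⨆ i, k i < δ.ord := by
    refine Ordinal.iSup_lt_of_lt_cof ?_ fun i => ?_
    · rw [hδ.isRegular.cof_ord, mk_pi, prod_const]
      simp only [mk_fin, lift_natCast, lift_uzero]
      exact (power_le_power_right (le_max_left #Y ℵ₀)).trans_lt
        ((by exact_mod_cast power_nat_le (le_max_right #Y ℵ₀) :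
          max #Y ℵ₀ ^ (n : Cardinal.{u}) ≤ max #Y ℵ₀).trans_lt (max_lt hYδ hδ.aleph0_lt))
    · obtain ⟨x, hx⟩ := hk i
      exact hx ▸ hgδ x
  have h1 : ocollapse U g ≤ oemb U (⨆ i, k i) := by
    refine le_of_not_gt fun hlt => ?_
    obtain ⟨x, hx, i, -, hi⟩ := (((ocollapse_lt_iff (.const _) hg).1 hlt).and hgk).exists
    rw [hi] at hx
    exact hx.not_ge (Ordinal.le_iSup k i)
  have h2 := oemb_lt_of_isStrongLimit hδ.isStrongPrelimit hδ.aleph0_lt hL hY hYδ hsup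
  exact (h1.trans_lt h2).ne he

/-- The embedding given by the iteration of length `(2 ^ ν)⁺` of the ultrafilter of a label. -/
noncomputable def Label.block (ℓ : Label κ) (ν : Cardinal.{u}) (y : ZFSet.{u}) : ZFSet.{u} :=
  emb (fun _ : (Order.succ ((2 : Cardinal.{u}) ^ ν)).ord.ToType => ℓ.ult) y

/-- The coordinate functions represent a strictly increasing sequence of length `β` below the image
of the measurable cardinal: a later coordinate exceeds an earlier one almost surely. -/
theorem Label.le_oemb_const (ℓ : Label κ) (β : Ordinal.{u}) :
    β ≤ oemb (fun _ : β.ToType => ℓ.ult) ℓ.card.ord := by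
  let c : β.ToType → Ordinal.{u} := fun i =>
    ocollapse (fun _ : β.ToType => ℓ.ult) fun x => rk (x i)
  have hs : ∀ i : β.ToType, FinSupp fun x : β.ToType → κ.ord.ToType => rk (x i) :=
    fun i => (FinSupp.coord i).comp rk
  have hc : StrictMono c := by
    intro i k hik
    refine (ocollapse_lt_iff (hs i) (hs k)).2 (eventually_of_update (a := k) (s := {i})
      (by simpa using hik) (P := fun x => rk (x i) < rk (x k)) (fun x y hxy => ?_) ?_)
    · dsimp only
      rw [hxy i (by simp), hxy k (by simp)]
    · filter_upwards [eventually_coord (U := fun _ : β.ToType => ℓ.ult) (i := i) ℓ.large]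
        with x hx
      filter_upwards [ℓ.unbounded _ hx] with z hz
      simpa [Function.update_of_ne hik.ne] using hz
  have hcl : ∀ i, c i < oemb (fun _ : β.ToType => ℓ.ult) ℓ.card.ord := fun i =>
    (ocollapse_lt_iff (hs i) (.const _)).2 (eventually_coord (Y := {x | rk x < ℓ.card.ord}) ℓ.large)
  have hle : ∀ i : β.ToType, rk i ≤ c i := by
    intro i
    induction i using (wellFounded_lt (α := β.ToType)).induction with
    | _ i ih =>
      refine le_of_not_gt fun hlt => ?_
      have hk : elt (c i) (hlt.trans (rk_lt i)) < i := by
        rw [← rk_lt_rk, rk_elt]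
        exact hlt
      have h1 := ih _ hk
      rw [rk_elt] at h1
      exact (hc hk).not_ge h1
  refine le_of_not_gt fun hlt => ?_
  have h1 := hle (elt _ hlt)
  rw [rk_elt] at h1
  exact (hcl _).not_ge h1

theorem isConcat_toType {γ β : Ordinal.{u}} (hγ : γ < β) (hβ : ∀ θ < β, γ + θ < β) :
    IsConcat (N := β.ToType) (fun i : γ.ToType => elt (rk i) ((rk_lt i).trans hγ))
      (fun i : β.ToType => elt (γ + rk i) (hβ _ (rk_lt i))) where
  mono₁ := fun i k h => by
    rw [← rk_lt_rk, rk_elt, rk_elt]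
    exact rk_lt_rk.2 h
  mono₂ := fun i k h => by
    rw [← rk_lt_rk, rk_elt, rk_elt, add_lt_add_iff_left]
    exact rk_lt_rk.2 h
  lt := fun i k => by
    rw [← rk_lt_rk, rk_elt, rk_elt]
    exact (rk_lt i).trans_le le_self_add
  cover := fun n => by
    rcases lt_or_ge (rk n) γ with h | h
    · exact .inl ⟨elt _ h, rk_injective (by simp)⟩
    · refine .inr ⟨elt (rk n - γ) ((Ordinal.sub_le_self _ _).trans_lt (rk_lt n)),
        rk_injective ?_⟩
      simp [Ordinal.add_sub_cancel_of_le h]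

/-- The ordinal (2^ν')⁺ is additively indecomposable and absorbs (2^ν)⁺ on the left, so performing
the shorter iteration first does not change the total iteration. -/
theorem Label.block_block (ℓ : Label κ) {ν ν' : Cardinal.{u}} (hν : ℓ.card ≤ ν)
    (h : (2 : Cardinal.{u}) ^ ν < 2 ^ ν') (y : ZFSet.{u}) :
    ℓ.block ν (ℓ.block ν' y) = ℓ.block ν' y := by
  have hνν' : ν < ν' := lt_of_not_ge fun h' => h.not_ge (power_le_power_left two_ne_zero h')
  have h0 : ℵ₀ ≤ ν' := ℓ.inaccessible.aleph0_lt.le.trans (hν.trans hνν'.le)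
  have h0' : ℵ₀ ≤ (2 : Cardinal.{u}) ^ ν' := h0.trans (cantor ν').le
  have hlt : (Order.succ ((2 : Cardinal.{u}) ^ ν)).ord <
      (Order.succ ((2 : Cardinal.{u}) ^ ν')).ord :=
    ord_lt_ord.2 (Order.succ_lt_succ h)
  have hc := isConcat_toType hlt fun θ hθ =>
    Ordinal.isPrincipal_add_ord (h0'.trans (Order.le_succ _)) hlt hθ
  refine emb_emb_succ (U := fun _ => ℓ.ult) (V := ℓ.ult) h0 hc ?_
    (Y := {x | rk x < ℓ.card.ord}) (fun _ => ℓ.large)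
    ((mk_rk_lt ℓ.card).trans (hν.trans hνν'.le)) (fun _ => rfl) y
  rw [mk_ord_toType]
  exact Order.succ_le_of_lt h

theorem Label.block_injective (ℓ : Label κ) (ν : Cardinal.{u}) :
    Function.Injective (ℓ.block ν) := emb_injective

theorem Label.block_ne_self (ℓ : Label κ) {ν ν' : Cardinal.{u}} (hν : ℓ.card ≤ ν)
    (h : (2 : Cardinal.{u}) ^ ν < 2 ^ ν') {y : ZFSet.{u}} (hy : ℓ.block ν y ≠ y) :
    ℓ.block ν' y ≠ y := fun h' => hy (by
  have := ℓ.block_block hν h y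
  rwa [h'] at this)

/-- If the two images were equal, the shorter iteration would fix its own image of `y`; by
injectivity it would fix `y`, and then so would the longer one. -/
theorem Label.block_ne_block (ℓ : Label κ) {ν ν' : Cardinal.{u}} (hν : ℓ.card ≤ ν)
    (h : (2 : Cardinal.{u}) ^ ν < 2 ^ ν') {y : ZFSet.{u}} (hy : ℓ.block ν' y ≠ y) :
    ℓ.block ν y ≠ ℓ.block ν' y := fun h' => hy (by
  have := ℓ.block_block hν h y
  rw [← h'] at this
  exact (h' ▸ ℓ.block_injective ν this))

/-- A subset of `κ` that is fixed below `κ` by all iterations of a label is determined by its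
restriction to the cardinal of the label. -/
theorem Label.eq_of_fixed (ℓ : Label κ) {y z : ZFSet.{u}}
    (hy : y ⊆ κ.ord.toZFSet) (hz : z ⊆ κ.ord.toZFSet)
    (hyf : ∀ ν, ℓ.card ≤ ν → ν < κ → ∀ θ < κ.ord, (θ.toZFSet ∈ ℓ.block ν y ↔ θ.toZFSet ∈ y))
    (hzf : ∀ ν, ℓ.card ≤ ν → ν < κ → ∀ θ < κ.ord, (θ.toZFSet ∈ ℓ.block ν z ↔ θ.toZFSet ∈ z))
    (h : ∀ θ < ℓ.card.ord, (θ.toZFSet ∈ y ↔ θ.toZFSet ∈ z)) : y = z := by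
  have key : ∀ θ < κ.ord, (θ.toZFSet ∈ y ↔ θ.toZFSet ∈ z) := by
    intro θ hθ
    set ν := max ℓ.card θ.card with hν
    have hνκ : ν < κ := max_lt ℓ.lt (lt_ord.1 hθ)
    have hθβ : θ < (Order.succ ((2 : Cardinal.{u}) ^ ν)).ord :=
      lt_ord.2 ((le_max_right _ _).trans_lt ((cantor ν).trans (Order.lt_succ _)))
    -- Since `θ` is below the length of the iteration, it is below the image of `ℓ.card`. Membership
    -- of `θ` in the image is thus decided by the set below `ℓ.card`.
    obtain ⟨g, hg, hg', -, he⟩ := exists_ocollapse_eq (.const ℓ.card.ord)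
      (hθβ.trans_le (ℓ.le_oemb_const _))
    have hgδ : ∀ x, g x < ℓ.card.ord := fun x =>
      (hg' x).elim id fun h => h ▸ ℓ.inaccessible.isRegular.ord_pos
    rw [← hyf ν (le_max_left _ _) hνκ _ hθ, ← hzf ν (le_max_left _ _) hνκ _ hθ, Label.block,
      Label.block, ← he, toZFSet_ocollapse_mem_emb hg, toZFSet_ocollapse_mem_emb hg]
    exact eventually_congr (Eventually.of_forall fun x => h _ (hgδ x))
  ext w
  constructor
  · intro hw
    obtain ⟨θ, hθ, rfl⟩ := Ordinal.mem_toZFSet_iff.1 (hy hw)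
    exact (key θ hθ).1 hw
  · intro hw
    obtain ⟨θ, hθ, rfl⟩ := Ordinal.mem_toZFSet_iff.1 (hz hw)
    exact (key θ hθ).2 hw

/-- If some iteration of a label moves `y` below `κ`, then there are many lengths of iterations
that lead to pairwise different images of `y`. -/
theorem Label.exists_lengths (ℓ : Label κ)
    (hκ : ∀ ν < κ, ∃ δ, ν < δ ∧ δ < κ ∧ IsInaccessible δ) {y : ZFSet.{u}}
    (hy : ∃ ν, ℓ.card ≤ ν ∧ ν < κ ∧ ∃ θ < κ.ord, ¬ (θ.toZFSet ∈ ℓ.block ν y ↔ θ.toZFSet ∈ y))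
    (I : Type u) (hI : #I < κ) :
    ∃ (o : I → Cardinal.{u}) (T : Cardinal.{u}), T < κ ∧ ℓ.card < T ∧ IsInaccessible T ∧
      (∀ i, ℓ.card ≤ o i ∧ o i < T) ∧
      ∀ i i', i ≠ i' → ∃ θ < T.ord,
        ¬ (θ.toZFSet ∈ ℓ.block (o i) y ↔ θ.toZFSet ∈ ℓ.block (o i') y) := by
  obtain ⟨ν₀, hν₀, hν₀κ, θ₀, hθ₀, hne⟩ := hy
  obtain ⟨T, hT, hTκ, hTi⟩ := hκ (max (max ν₀ θ₀.card) #I) (max_lt (max_lt hν₀κ (lt_ord.1 hθ₀)) hI)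
  have hν₀T : ν₀ < T := ((le_max_left _ _).trans (le_max_left _ _)).trans_lt hT
  have hθ₀T : θ₀ < T.ord := lt_ord.2 (((le_max_right _ _).trans (le_max_left _ _)).trans_lt hT)
  have hIT : #I < T := (le_max_right _ _).trans_lt hT
  have hℓT : ℓ.card < T := hν₀.trans_lt hν₀T
  set Y : Set κ.ord.ToType := {x | rk x < ℓ.card.ord} with hY
  have hYT : #Y < T := (mk_rk_lt ℓ.card).trans_lt hℓT
  have hlen : ∀ ν < T, #(Order.succ ((2 : Cardinal.{u}) ^ ν)).ord.ToType < T := by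
    intro ν hν
    rw [mk_ord_toType]
    exact hTi.isSuccLimit.succ_lt (hTi.isStrongPrelimit hν)
  -- Images of `y` might differ only above `T`. The images of `y'` are subsets of `T`, because `T`
  -- is a fixed point, so a difference between them shows below `T`.
  set y' := y ∩ T.ord.toZFSet with hy'
  have hfix : ∀ ν < T, oemb (fun _ : (Order.succ ((2 : Cardinal.{u}) ^ ν)).ord.ToType => ℓ.ult)
      T.ord = T.ord := fun ν hν =>
    oemb_ord_of_isInaccessible hTi (hlen ν hν) (Y := Y) (fun _ => ℓ.large) hYT
  have hrestr : ∀ ν, ∀ θ < T.ord, (θ.toZFSet ∈ ℓ.block ν y' ↔ θ.toZFSet ∈ ℓ.block ν y) := by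
    intro ν θ hθ
    obtain ⟨g, hg, hgT, rfl⟩ := exists_ocollapse_of_lt
      (U := fun _ : (Order.succ ((2 : Cardinal.{u}) ^ ν)).ord.ToType => ℓ.ult) hθ
    rw [Label.block, Label.block, toZFSet_ocollapse_mem_emb hg, toZFSet_ocollapse_mem_emb hg]
    refine eventually_congr (Eventually.of_forall fun x => ?_)
    rw [hy', ZFSet.mem_inter, Ordinal.toZFSet_mem_toZFSet_iff]
    exact and_iff_left (hgT x)
  have hsub : ∀ ν < T, ℓ.block ν y' ⊆ T.ord.toZFSet := by
    intro ν hν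
    have h1 := emb_subset (U := fun _ : (Order.succ ((2 : Cardinal.{u}) ^ ν)).ord.ToType => ℓ.ult)
      (show y' ⊆ T.ord.toZFSet from fun w hw => (ZFSet.mem_inter.1 hw).2)
    rwa [emb_toZFSet, hfix ν hν] at h1
  have hmove : ℓ.block ν₀ y' ≠ y' := by
    intro h
    refine hne ?_
    rw [← hrestr ν₀ θ₀ hθ₀T, h, hy', ZFSet.mem_inter, Ordinal.toZFSet_mem_toZFSet_iff]
    exact and_iff_left hθ₀T
  have hdiff : ∀ ν ν', ν₀ ≤ ν → (2 : Cardinal.{u}) ^ ν₀ < 2 ^ ν' → ν < T → ν' < T →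
      (2 : Cardinal.{u}) ^ ν < 2 ^ ν' →
      ∃ θ < T.ord, ¬ (θ.toZFSet ∈ ℓ.block ν y ↔ θ.toZFSet ∈ ℓ.block ν' y) := by
    intro ν ν' h1 h2 h3 h4 h5
    have h6 := ℓ.block_ne_block (hν₀.trans h1) h5 (ℓ.block_ne_self hν₀ h2 hmove)
    by_contra! hcon
    refine h6 (ZFSet.ext fun w => ⟨fun hw => ?_, fun hw => ?_⟩)
    · obtain ⟨θ, hθ, rfl⟩ := Ordinal.mem_toZFSet_iff.1 (hsub ν h3 hw)
      rwa [hrestr ν' θ hθ, ← hcon θ hθ, ← hrestr ν θ hθ]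
    · obtain ⟨θ, hθ, rfl⟩ := Ordinal.mem_toZFSet_iff.1 (hsub ν' h4 hw)
      rwa [hrestr ν θ hθ, hcon θ hθ, ← hrestr ν' θ hθ]
  have hIle : #I ≤ #T.ord.ToType := by rw [mk_ord_toType]; exact hIT.le
  obtain ⟨f⟩ := Cardinal.le_def _ _ |>.1 hIle
  -- Lengths are taken from the beth sequence, where 2^ν is strictly increasing. Starting at `ν₀.ord
  -- + 1` ensures 2^ν₀ ≤ ℶ_σ.
  set σ : Ordinal.{u} := ν₀.ord + 1 with hσ
  have hσT : σ < T.ord := (isSuccLimit_ord hTi.aleph0_lt.le).add_one_lt (ord_lt_ord.2 hν₀T)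
  let a : I → Ordinal.{u} := fun i => σ + rk (f i)
  have ha : ∀ i, a i < T.ord := fun i =>
    Ordinal.isPrincipal_add_ord hTi.aleph0_lt.le hσT (rk_lt (f i))
  have hainj : ∀ i i', i ≠ i' → a i ≠ a i' := fun i i' hii h => hii (by
    exact f.injective (rk_injective ((add_right_inj σ).1 h)))
  have hpow : ∀ b, (2 : Cardinal.{u}) ^ ℶ_ b = ℶ_ (b + 1) := fun b => (beth_add_one b).symm
  have hge : ∀ i, ℶ_ σ ≤ ℶ_ (a i) := fun i => beth_le_beth.2 le_self_add
  have hσν : ν₀ < ℶ_ σ := by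
    rw [hσ, beth_add_one]
    exact (le_beth_ord ν₀).trans_lt (cantor _)
  have hoT : ∀ i, ℶ_ (a i) < T := fun i => by
    rw [← hTi.beth_ord]
    exact beth_lt_beth.2 (ha i)
  have h2 : ∀ i, (2 : Cardinal.{u}) ^ ν₀ < 2 ^ ℶ_ (a i) := by
    intro i
    refine lt_of_le_of_lt ?_ (cantor _)
    refine le_trans ?_ (hge i)
    rw [hσ, beth_add_one]
    exact power_le_power_left two_ne_zero (le_beth_ord ν₀)
  refine ⟨fun i => ℶ_ (a i), T, hTκ, hℓT, hTi, fun i => ⟨?_, hoT i⟩, fun i i' hii => ?_⟩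
  · exact hν₀.trans (hσν.le.trans (hge i))
  · rcases lt_or_gt_of_ne (hainj i i' hii) with h | h
    · refine hdiff _ _ (hσν.le.trans (hge i)) (h2 i') (hoT i) (hoT i') ?_
      rw [hpow, hpow]
      exact beth_lt_beth.2 (by simpa using h)
    · obtain ⟨θ, hθ, hθ'⟩ := hdiff _ _ (hσν.le.trans (hge i')) (h2 i) (hoT i') (hoT i) (by
        rw [hpow, hpow]
        exact beth_lt_beth.2 (by simpa using h))
      exact ⟨θ, hθ, fun h => hθ' h.symm⟩

end Block

/-! ### Choosing a set that is moved by many labels -/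

section Moves

variable {κ : Cardinal.{u}} [Nonempty κ.ord.ToType]

/-- Some iteration of the label moves `y` below `κ`. -/
def Label.Moves (ℓ : Label κ) (y : ZFSet.{u}) : Prop :=
  ∃ ν, ℓ.card ≤ ν ∧ ν < κ ∧ ∃ θ < κ.ord, ¬ (θ.toZFSet ∈ ℓ.block ν y ↔ θ.toZFSet ∈ y)

/-- If `D` has more than `κ` elements, then some element of `D` is moved by each of `κ` many
labels. -/
theorem exists_moves (hκ0 : ℵ₀ ≤ κ) (hκ : ∀ ν < κ, (2 : Cardinal.{u}) ^ ν < κ)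
    (ℓ : κ.ord.ToType → Label κ) {D : ZFSet.{u}} (hD : D ⊆ ZFSet.powerset κ.ord.toZFSet)
    (hcard : κ < D.card) : ∃ y ∈ D, ∀ i, (ℓ i).Moves y := by
  by_contra hcon
  have h1 : ∀ y : D, ∃ i, ¬ (ℓ i).Moves y.1 := fun y => by
    by_contra h
    exact hcon ⟨y.1, y.2, fun i => by_contra fun h' => h ⟨i, h'⟩⟩
  choose i hi using h1
  have hfix : ∀ y : D, ∀ ν, (ℓ (i y)).card ≤ ν → ν < κ → ∀ θ < κ.ord,
      (θ.toZFSet ∈ (ℓ (i y)).block ν y.1 ↔ θ.toZFSet ∈ y.1) := fun y ν h1 h2 θ h3 =>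
    by_contra fun h4 => hi y ⟨ν, h1, h2, θ, h3, h4⟩
  -- An element not moved by the label `i y` is recovered from that index and its trace on the
  -- cardinal of the label.
  let f : D → Σ k : κ.ord.ToType, Set (ℓ k).card.ord.ToType := fun y =>
    ⟨i y, {a | (rk a).toZFSet ∈ y.1}⟩
  have hf : Function.Injective f := by
    intro y z hyz
    have h1 : i y = i z := congrArg Sigma.fst hyz
    have h2 : ∀ θ < (ℓ (i y)).card.ord, (θ.toZFSet ∈ y.1 ↔ θ.toZFSet ∈ z.1) := by
      intro θ hθ
      have h3 : ∀ p q : Σ k : κ.ord.ToType, Set (ℓ k).card.ord.ToType, p = q →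
          ∀ θ (h : θ < (ℓ p.1).card.ord) (h' : θ < (ℓ q.1).card.ord),
            (elt θ h ∈ p.2 ↔ elt θ h' ∈ q.2) := by
        rintro p _ rfl θ h h'
        rfl
      have := h3 _ _ hyz θ hθ (by rw [← hyz]; exact hθ)
      simpa [f] using this
    exact Subtype.ext ((ℓ (i y)).eq_of_fixed (ZFSet.mem_powerset.1 (hD y.2))
      (ZFSet.mem_powerset.1 (hD z.2)) (hfix y) (h1 ▸ hfix z) h2)
  have hle := mk_le_of_injective (hf.comp (equivShrink D).symm.injective)
  rw [mk_sigma] at hle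
  refine hcard.not_ge (hle.trans ((sum_le_sum _ (fun _ => κ) fun k => ?_).trans ?_))
  · rw [mk_set, mk_ord_toType]
    exact (hκ _ (ℓ k).lt).le
  · rw [sum_const', mk_ord_toType, mul_eq_self hκ0]

end Moves

/-! ### Towers of labels -/

theorem exists_forall_of_forall_exists_lt {Λ : Type*} [LinearOrder Λ] [WellFoundedLT Λ]
    {A : Type*} {P : ∀ ξ : Λ, (Iio ξ → A) → A → Prop} (h : ∀ ξ g, ∃ a, P ξ g a) :
    ∃ F : Λ → A, ∀ ξ, P ξ (fun ζ => F ζ) (F ξ) := by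
  choose G hG using h
  let F : Λ → A := (wellFounded_lt (α := Λ)).fix fun ξ g => G ξ fun ζ => g ζ ζ.2
  refine ⟨F, fun ξ => ?_⟩
  have : F ξ = G ξ fun ζ => F ζ := WellFounded.fix_eq _ _ _
  rw [this]
  exact hG _ _

section Tower

variable {κ : Cardinal.{u}} [Nonempty κ.ord.ToType]

/-- A cofinal sequence of labels of length `cof κ`, together with lengths of iterations of these
labels that depend on initial segments of functions from `cof κ` to the ordinals, such that the
corresponding images of `y` differ. -/
structure Tower (κ : Cardinal.{u}) [Nonempty κ.ord.ToType] (y : ZFSet.{u}) (ρ : Cardinal.{u}) where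
  label : κ.ord.cof.ord.ToType → Label κ
  len : κ.ord.cof.ord.ToType → (κ.ord.cof.ord.ToType → Ordinal.{u}) → Cardinal.{u}
  top : κ.ord.cof.ord.ToType → Cardinal.{u}
  top_lt : ∀ ξ, top ξ < κ
  top_inaccessible : ∀ ξ, IsInaccessible (top ξ)
  card_lt_top : ∀ ξ, (label ξ).card < top ξ
  lt_card : ∀ ξ, ρ < (label ξ).card
  mk_Iio_lt : ∀ ξ, #(Iio ξ) < (label ξ).card
  exists_bound : ∀ ξ, ∃ t < (label ξ).card, ∀ ζ < ξ, top ζ ≤ t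
  cofinal : ∀ ν < κ, ∃ ξ, ν < (label ξ).card
  card_le_len : ∀ ξ f, (label ξ).card ≤ len ξ f
  len_lt_top : ∀ ξ f, len ξ f < top ξ
  len_congr : ∀ ξ f g, (∀ ζ < ξ, min (f ζ) (label ξ).card.ord = min (g ζ) (label ξ).card.ord) →
    len ξ f = len ξ g
  differ : ∀ ξ f g, ¬ (∀ ζ < ξ, min (f ζ) (label ξ).card.ord = min (g ζ) (label ξ).card.ord) →
    ∃ θ < (top ξ).ord,
      ¬ (θ.toZFSet ∈ (label ξ).block (len ξ f) y ↔ θ.toZFSet ∈ (label ξ).block (len ξ g) y)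

/-- Truncation leaves fewer than κ codes at each position, so `Label.exists_lengths` can give each
code its own length. Labels are then picked recursively above all earlier bounds, whose supremum is
below κ because there are fewer than cof(κ) of them. -/
theorem exists_tower (hκ2 : ∀ ν < κ, (2 : Cardinal.{u}) ^ ν < κ)
    (hκ : ∀ ν < κ, ∃ δ, ν < δ ∧ δ < κ ∧ IsInaccessible δ)
    {A : Type*} (ℓ : A → Label κ) (hℓ : ∀ ν < κ, ∃ i, ν < (ℓ i).card) {y : ZFSet.{u}}
    (hy : ∀ i, (ℓ i).Moves y) {ρ : Cardinal.{u}} (hρ : ρ < κ) : Nonempty (Tower κ y ρ) := by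
  have hcof : κ.ord.cof ≤ κ := Ordinal.cof_ord_le κ
  have hIio : ∀ ξ : κ.ord.cof.ord.ToType, #(Iio ξ) < κ.ord.cof := mk_Iio_ord_lt
  -- The successor makes room for the value `(ℓ i).card.ord`, which truncation assigns to all larger
  -- ordinals.
  let I : A → κ.ord.cof.ord.ToType → Type u := fun i ξ =>
    Iio ξ → ((ℓ i).card.ord + 1).ToType
  have hI : ∀ i ξ, #(I i ξ) < κ := by
    intro i ξ
    set m := max #(Iio ξ) (ℓ i).card with hm
    have hmκ : m < κ := max_lt ((hIio ξ).trans_le hcof) (ℓ i).lt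
    have hm0 : ℵ₀ ≤ m := (ℓ i).inaccessible.aleph0_lt.le.trans (le_max_right _ _)
    have h1 : #((ℓ i).card.ord + 1).ToType ≤ m := by
      rw [mk_toType, Ordinal.card_add, card_ord, Ordinal.card_one,
        add_one_eq (ℓ i).inaccessible.aleph0_lt.le]
      exact le_max_right _ _
    rw [← power_def]
    refine ((power_le_power_right h1).trans
      (power_le_power_left (ne_of_gt (aleph0_pos.trans_le hm0))
        (le_max_left _ _ : #(Iio ξ) ≤ m))).trans_lt ?_
    rw [power_self_eq hm0]
    exact hκ2 _ hmκ
  choose o T hTκ hℓT hTi ho hdiff using fun i ξ => (ℓ i).exists_lengths hκ (hy i) (I i ξ) (hI i ξ)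
  obtain ⟨S, hS, hSc⟩ := Order.exists_cof_eq (α := κ.ord.ToType)
  rw [Ordinal.cof_toType, ← mk_ord_toType κ.ord.cof] at hSc
  obtain ⟨e⟩ := Cardinal.eq.1 hSc
  obtain ⟨ix, hix⟩ := exists_forall_of_forall_exists_lt (Λ := κ.ord.cof.ord.ToType) (A := A)
    (P := fun ξ g i => ρ < (ℓ i).card ∧ #(Iio ξ) < (ℓ i).card ∧
      (rk (e.symm ξ).1).card < (ℓ i).card ∧ (⨆ ζ : Iio ξ, T (g ζ) ζ) < (ℓ i).card) (by
    intro ξ g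
    have h1 : (⨆ ζ : Iio ξ, T (g ζ) ζ) < κ :=
      iSup_lt_of_lt_cof_ord (hIio ξ) fun ζ => hTκ _ _
    obtain ⟨i, hi⟩ := hℓ (max (max ρ #(Iio ξ))
      (max (rk (e.symm ξ).1).card (⨆ ζ : Iio ξ, T (g ζ) ζ)))
      (max_lt (max_lt hρ ((hIio ξ).trans_le hcof)) (max_lt (lt_ord.1 (rk_lt _)) h1))
    simp only [max_lt_iff] at hi
    exact ⟨i, hi.1.1, hi.1.2, hi.2.1, hi.2.2⟩)
  let tr : ∀ ξ, (κ.ord.cof.ord.ToType → Ordinal.{u}) → I (ix ξ) ξ := fun ξ f ζ =>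
    elt (min (f ζ) (ℓ (ix ξ)).card.ord) (Order.lt_add_one_iff.2 (min_le_right _ _))
  have htr : ∀ ξ f g, tr ξ f = tr ξ g ↔
      ∀ ζ < ξ, min (f ζ) (ℓ (ix ξ)).card.ord = min (g ζ) (ℓ (ix ξ)).card.ord := by
    intro ξ f g
    refine ⟨fun h ζ hζ => ?_, fun h => funext fun ζ => rk_injective ?_⟩
    · simpa [tr] using congrArg rk (congrFun h ⟨ζ, hζ⟩)
    · simpa [tr] using h ζ ζ.2
  refine ⟨⟨fun ξ => ℓ (ix ξ), fun ξ f => o (ix ξ) ξ (tr ξ f), fun ξ => T (ix ξ) ξ,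
    fun ξ => hTκ _ _, fun ξ => hTi _ _, fun ξ => hℓT _ _, fun ξ => (hix ξ).1,
    fun ξ => (hix ξ).2.1, fun ξ => ⟨_, (hix ξ).2.2.2, fun ζ hζ => ?_⟩, fun ν hν => ?_,
    fun ξ f => (ho _ _ _).1, fun ξ f => (ho _ _ _).2, fun ξ f g h => ?_, fun ξ f g h => ?_⟩⟩
  · exact le_ciSup (f := fun ζ : Iio ξ => T (ix ζ) ζ) (bddAbove_of_small) ⟨ζ, hζ⟩
  · obtain ⟨b, hb, hνb⟩ := hS (elt ν.ord (ord_lt_ord.2 hν))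
    refine ⟨e ⟨b, hb⟩, lt_of_le_of_lt ?_ (hix (e ⟨b, hb⟩)).2.2.1⟩
    rw [Equiv.symm_apply_apply]
    rw [← rk_le_rk, rk_elt] at hνb
    simpa using Ordinal.card_le_card hνb
  · rw [(htr ξ f g).2 h]
  · exact hdiff _ _ _ _ fun h' => h ((htr ξ f g).1 h')

end Tower

/-! ### Iterations along sequences of labels -/

section Widths

variable {κ : Cardinal.{u}} {Λ : Type u}

/-- The index order of an iteration that uses the `ξ`-th label `w ξ` many times. -/
def Steps (κ : Cardinal.{u}) (w : Λ → Ordinal.{u}) : Type u :=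
  {p : Λ ×ₗ κ.ord.ToType // rk (ofLex p).2 < w (ofLex p).1}

noncomputable instance [LinearOrder Λ] (w : Λ → Ordinal.{u}) : LinearOrder (Steps κ w) :=
  inferInstanceAs (LinearOrder {p : Λ ×ₗ κ.ord.ToType // rk (ofLex p).2 < w (ofLex p).1})

instance [LinearOrder Λ] [WellFoundedLT Λ] (w : Λ → Ordinal.{u}) : WellFoundedLT (Steps κ w) :=
  inferInstanceAs (WellFoundedLT {p : Λ ×ₗ κ.ord.ToType // rk (ofLex p).2 < w (ofLex p).1})

namespace Steps

variable {w : Λ → Ordinal.{u}}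

/-- The position of the label used at a step. -/
def pos (p : Steps κ w) : Λ := (ofLex p.1).1

/-- The number of previous uses of the label used at a step. -/
def idx (p : Steps κ w) : κ.ord.ToType := (ofLex p.1).2

/-- The step with given position and number of previous uses. -/
def mk (ξ : Λ) (b : κ.ord.ToType) (h : rk b < w ξ) : Steps κ w := ⟨toLex (ξ, b), h⟩

@[simp] theorem idx_mk (ξ : Λ) (b : κ.ord.ToType) (h : rk b < w ξ) : (mk ξ b h).idx = b := rfl

theorem rk_idx_lt (p : Steps κ w) : rk p.idx < w p.pos := p.2

theorem lt_iff [LinearOrder Λ] {p q : Steps κ w} :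
    p < q ↔ p.pos < q.pos ∨ p.pos = q.pos ∧ p.idx < q.idx :=
  Prod.Lex.lt_iff

theorem ext {p q : Steps κ w} (h : p.pos = q.pos) (h' : p.idx = q.idx) : p = q :=
  Subtype.ext (Prod.ext h h')

end Steps

open Classical in
/-- The restriction of a sequence of widths to the positions with a property. -/
noncomputable def cut (P : Λ → Prop) (w : Λ → Ordinal.{u}) : Λ → Ordinal.{u} :=
  fun ξ => if P ξ then w ξ else 0

theorem cut_of {P : Λ → Prop} {w : Λ → Ordinal.{u}} {ξ : Λ} (h : P ξ) : cut P w ξ = w ξ := if_pos h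

theorem cut_congr {P : Λ → Prop} {w w' : Λ → Ordinal.{u}} (h : ∀ ξ, P ξ → w ξ = w' ξ) :
    cut P w = cut P w' := funext fun ξ => by
  by_cases hξ : P ξ <;> simp [cut, hξ, h]

theorem Steps.prop_pos {P : Λ → Prop} {w : Λ → Ordinal.{u}} (p : Steps κ (cut P w)) : P p.pos := by
  by_contra h
  have := p.rk_idx_lt
  rw [cut, if_neg h] at this
  exact not_lt_zero this

theorem mk_steps_cut_le {P : Λ → Prop} {w : Λ → Ordinal.{u}} {t : Cardinal.{u}}
    (h : ∀ ξ, P ξ → w ξ ≤ t.ord) : #(Steps κ (cut P w)) ≤ #{ξ // P ξ} * t := by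
  rw [← mk_ord_toType t, mul_def]
  refine mk_le_of_injective (f := fun p : Steps κ (cut P w) => (⟨p.pos, p.prop_pos⟩,
    elt (rk p.idx) (p.rk_idx_lt.trans_le (by rw [cut_of p.prop_pos]; exact h _ p.prop_pos))))
    fun p q hpq => ?_
  rw [Prod.mk.injEq] at hpq
  refine Steps.ext (congrArg Subtype.val hpq.1) (rk_injective ?_)
  simpa using congrArg rk hpq.2

/-- The inclusion of a part of an iteration. -/
noncomputable def cutIncl (P : Λ → Prop) (w : Λ → Ordinal.{u}) (p : Steps κ (cut P w)) :
    Steps κ w :=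
  .mk p.pos p.idx (by rw [← cut_of (w := w) p.prop_pos]; exact p.rk_idx_lt)

theorem cutIncl_strictMono [LinearOrder Λ] (P : Λ → Prop) (w : Λ → Ordinal.{u}) :
    StrictMono (cutIncl (κ := κ) P w) := fun _ _ h => Steps.lt_iff.2 (Steps.lt_iff.1 h)

theorem mem_range_cutIncl {P : Λ → Prop} {w : Λ → Ordinal.{u}} (p : Steps κ w) (h : P p.pos) :
    p ∈ range (cutIncl (κ := κ) P w) :=
  ⟨.mk p.pos p.idx (by rw [cut_of h]; exact p.rk_idx_lt), Steps.ext rfl rfl⟩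

/-- The ultrafilters of an iteration. -/
def ults (ℓ : Λ → Label κ) (w : Λ → Ordinal.{u}) : Steps κ w → CUltrafilter κ.ord.ToType :=
  fun p => (ℓ p.pos).ult

theorem Label.complete_of_le (ℓ : Label κ) {c : Cardinal.{u}} (h : c ≤ ℓ.card) :
    CardinalInterFilter (ℓ.ult.1 : Filter κ.ord.ToType) c :=
  @CardinalInterFilter.of_cardinalInterFilter_of_le _ _ _ ℓ.complete _ h

variable [Nonempty κ.ord.ToType] [LinearOrder Λ] [WellFoundedLT Λ]

theorem toZFSet_mem_emb_cut {ℓ : Λ → Label κ} {w : Λ → Ordinal.{u}} {P : Λ → Prop}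
    (hP : ∀ a b, P a → ¬ P b → a < b) {c : Cardinal.{u}} (hc : ∀ b, ¬ P b → c ≤ (ℓ b).card)
    (y : ZFSet.{u}) {θ : Ordinal.{u}} (hθ : θ < c.ord) :
    θ.toZFSet ∈ emb (ults ℓ w) y ↔ θ.toZFSet ∈ emb (ults ℓ (cut P w)) y :=
  toZFSet_mem_emb_pull (cutIncl_strictMono P w)
    (fun i hi a => Steps.lt_iff.2 (.inl (hP _ _ a.prop_pos fun h => hi (mem_range_cutIncl i h))))
    (fun i hi => (ℓ i.pos).complete_of_le (hc _ fun h => hi (mem_range_cutIncl i h)))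
    (fun _ => rfl) y hθ

theorem oemb_cut {ℓ : Λ → Label κ} {w : Λ → Ordinal.{u}} {P : Λ → Prop}
    (hP : ∀ a b, P a → ¬ P b → a < b) {c : Cardinal.{u}} (hc : ∀ b, ¬ P b → c ≤ (ℓ b).card)
    {θ : Ordinal.{u}} (hθ : θ < c.ord) :
    oemb (ults ℓ w) θ = oemb (ults ℓ (cut P w)) θ :=
  ocollapse_pull (h := fun _ => θ) (cutIncl_strictMono P w)
    (fun i hi a => Steps.lt_iff.2 (.inl (hP _ _ a.prop_pos fun h => hi (mem_range_cutIncl i h))))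
    (fun i hi => (ℓ i.pos).complete_of_le (hc _ fun h => hi (mem_range_cutIncl i h)))
    (fun _ => rfl) (.const θ) fun _ => hθ

theorem toZFSet_oemb_mem_emb {L X : Type u} [LinearOrder L] [WellFoundedLT L] [Nonempty X]
    {U : L → CUltrafilter X} {θ : Ordinal.{u}} {z : ZFSet.{u}} :
    (oemb U θ).toZFSet ∈ emb U z ↔ θ.toZFSet ∈ z := by
  refine (toZFSet_ocollapse_mem_emb (.const θ)).trans eventually_const

/-- An iteration whose last label is used `(2 ^ ν)⁺` many times. -/
theorem emb_cut_le {ℓ : Λ → Label κ} {w : Λ → Ordinal.{u}} {ξ : Λ} {ν t : Cardinal.{u}}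
    (hν : ℵ₀ ≤ ν) (hw : w ξ = (Order.succ ((2 : Cardinal.{u}) ^ ν)).ord)
    (hνκ : Order.succ ((2 : Cardinal.{u}) ^ ν) < κ)
    (hE : #(Steps κ (cut (· < ξ) w)) ≤ 2 ^ ν)
    (ht : ∀ ζ < ξ, (ℓ ζ).card ≤ t) (htν : t ≤ ν) (y : ZFSet.{u}) :
    emb (ults ℓ (cut (· < ξ) w)) ((ℓ ξ).block ν y) = emb (ults ℓ (cut (· ≤ ξ) w)) y := by
  have hcut : cut (· ≤ ξ) w ξ = w ξ := cut_of (P := (· ≤ ξ)) le_rfl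
  let e₁ : Steps κ (cut (· < ξ) w) → Steps κ (cut (· ≤ ξ) w) := fun p =>
    .mk p.pos p.idx (by
      rw [cut_of (P := (· ≤ ξ)) p.prop_pos.le, ← cut_of (P := (· < ξ)) (w := w) p.prop_pos]
      exact p.rk_idx_lt)
  have hb : ∀ b : (Order.succ ((2 : Cardinal.{u}) ^ ν)).ord.ToType, rk b < κ.ord :=
    fun b => (rk_lt b).trans (ord_lt_ord.2 hνκ)
  let e₂ : (Order.succ ((2 : Cardinal.{u}) ^ ν)).ord.ToType → Steps κ (cut (· ≤ ξ) w) := fun b =>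
    .mk ξ (elt (rk b) (hb b)) (by
      rw [hcut, hw, rk_elt]
      exact rk_lt b)
  have hc : IsConcat e₁ e₂ :=
    { mono₁ := fun p q h => Steps.lt_iff.2 (Steps.lt_iff.1 h)
      mono₂ := fun b b' h => Steps.lt_iff.2 (.inr ⟨rfl, by
        rw [← rk_lt_rk]
        simpa [e₂] using rk_lt_rk.2 h⟩)
      lt := fun p b => Steps.lt_iff.2 (.inl p.prop_pos)
      cover := fun p => by
        rcases (p.prop_pos : p.pos ≤ ξ).lt_or_eq with h | h
        · refine .inl ⟨.mk p.pos p.idx ?_, Steps.ext rfl rfl⟩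
          rw [cut_of (P := (· < ξ)) h, ← cut_of (P := (· ≤ ξ)) (w := w) h.le]
          exact p.rk_idx_lt
        · have h1 := p.rk_idx_lt
          rw [h, hcut, hw] at h1
          exact .inr ⟨elt (rk p.idx) h1, Steps.ext h.symm (rk_injective (by simp [e₂]))⟩ }
  refine emb_emb_succ (U := ults ℓ (cut (· ≤ ξ) w)) (V := (ℓ ξ).ult) hν hc hE
    (Y := {x | rk x < t.ord}) (fun p => ?_) ((mk_rk_lt t).trans htν) (fun _ => rfl) y
  exact mem_of_superset (ℓ p.pos).large fun x (hx : rk x < _) =>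
    hx.trans_le (ord_le_ord.2 (ht _ p.prop_pos))

/-- Iterations that use the `ξ`-th label differently differ. -/
theorem exists_not_iff_emb {ℓ : Λ → Label κ} {w w' : Λ → Ordinal.{u}} {ξ : Λ}
    {ν ν' t T : Cardinal.{u}}
    (hw : w ξ = (Order.succ ((2 : Cardinal.{u}) ^ ν)).ord)
    (hw' : w' ξ = (Order.succ ((2 : Cardinal.{u}) ^ ν')).ord)
    (hww' : ∀ ζ < ξ, w ζ = w' ζ)
    (hT : IsInaccessible T) (hTκ : T < κ) (hν : (ℓ ξ).card ≤ ν) (hνT : ν < T)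
    (hν' : (ℓ ξ).card ≤ ν') (hνT' : ν' < T)
    (hTℓ : ∀ ζ, ξ < ζ → T ≤ (ℓ ζ).card) (ht : ∀ ζ < ξ, (ℓ ζ).card ≤ t) (htw : ∀ ζ < ξ, w ζ ≤ t.ord)
    (htξ : t < (ℓ ξ).card) (hξ : #(Iio ξ) < (ℓ ξ).card) {y : ZFSet.{u}}
    (hy : ∃ θ < T.ord, ¬ (θ.toZFSet ∈ (ℓ ξ).block ν y ↔ θ.toZFSet ∈ (ℓ ξ).block ν' y)) :
    ∃ θ < T.ord, ¬ (θ.toZFSet ∈ emb (ults ℓ w) y ↔ θ.toZFSet ∈ emb (ults ℓ w') y) := by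
  obtain ⟨θ, hθ, hne⟩ := hy
  have hE : #(Steps κ (cut (· < ξ) w)) < (ℓ ξ).card :=
    (mk_steps_cut_le htw).trans_lt (mul_lt_of_lt (ℓ ξ).inaccessible.aleph0_lt.le hξ htξ)
  have hsucc : ∀ ν < T, Order.succ ((2 : Cardinal.{u}) ^ ν) < κ := fun ν hν =>
    (hT.isSuccLimit.succ_lt (hT.isStrongPrelimit hν)).trans hTκ
  have hcut : cut (· < ξ) w = cut (· < ξ) w' := cut_congr hww'
  have h0 := (ℓ ξ).inaccessible.aleph0_lt.le
  have hlow : ∀ a b : Λ, a ≤ ξ → ¬ b ≤ ξ → a < b := fun a b ha hb => ha.trans_lt (not_le.1 hb)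
  have h1 : oemb (ults ℓ (cut (· < ξ) w)) θ < T.ord :=
    oemb_lt_of_isStrongLimit hT.isStrongPrelimit hT.aleph0_lt (hE.trans (hν.trans_lt hνT))
      (Y := {x | rk x < t.ord}) (fun p => mem_of_superset (ℓ p.pos).large fun x (hx : rk x < _) =>
        hx.trans_le (ord_le_ord.2 (ht _ p.prop_pos)))
      ((mk_rk_lt t).trans_lt (htξ.trans (hν.trans_lt hνT))) hθ
  -- The witness is the image of `θ` under the common iteration before `ξ`. That iteration carries
  -- the two images under the `ξ`-th label to the images of `y` under the iterations up to `ξ`, and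
  -- later stages do not matter below `T`.
  refine ⟨_, h1, fun h => hne ?_⟩
  rw [toZFSet_mem_emb_cut (w := w) (P := (· ≤ ξ)) hlow (fun b hb => hTℓ b (not_le.1 hb)) _ h1,
    toZFSet_mem_emb_cut (w := w') (P := (· ≤ ξ)) hlow (fun b hb => hTℓ b (not_le.1 hb)) _ h1,
    ← emb_cut_le (h0.trans hν) hw (hsucc ν hνT) (hE.le.trans (hν.trans (cantor ν).le)) ht
      (htξ.le.trans hν) y,
    ← emb_cut_le (h0.trans hν') hw' (hsucc ν' hνT')
      (hcut ▸ hE.le.trans (hν'.trans (cantor ν').le)) ht (htξ.le.trans hν') y, ← hcut,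
    toZFSet_oemb_mem_emb, toZFSet_oemb_mem_emb] at h
  exact h

end Widths

/-! ### The iterations given by a tower -/

namespace Tower

variable {κ : Cardinal.{u}} [Nonempty κ.ord.ToType] {y : ZFSet.{u}} {ρ : Cardinal.{u}}
  (𝒯 : Tower κ y ρ)

/-- The number of uses of each label that is given by a function. -/
noncomputable def width (f : κ.ord.cof.ord.ToType → Ordinal.{u}) (ξ : κ.ord.cof.ord.ToType) :
    Ordinal.{u} :=
  (Order.succ ((2 : Cardinal.{u}) ^ 𝒯.len ξ f)).ord

/-- The image of `y` under the iteration that is given by a function. -/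
noncomputable def image (f : κ.ord.cof.ord.ToType → Ordinal.{u}) : ZFSet.{u} :=
  emb (ults 𝒯.label (𝒯.width f)) y

theorem top_lt_card {ζ ξ : κ.ord.cof.ord.ToType} (h : ζ < ξ) : 𝒯.top ζ < (𝒯.label ξ).card := by
  obtain ⟨t, ht, hζ⟩ := 𝒯.exists_bound ξ
  exact (hζ ζ h).trans_lt ht

theorem card_le_card {ζ ξ : κ.ord.cof.ord.ToType} (h : ζ ≤ ξ) :
    (𝒯.label ζ).card ≤ (𝒯.label ξ).card := by
  rcases h.eq_or_lt with rfl | h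
  · exact le_rfl
  · exact ((𝒯.card_lt_top ζ).trans (𝒯.top_lt_card h)).le

theorem top_le_top {ζ ξ : κ.ord.cof.ord.ToType} (h : ζ ≤ ξ) : 𝒯.top ζ ≤ 𝒯.top ξ := by
  rcases h.eq_or_lt with rfl | h
  · exact le_rfl
  · exact ((𝒯.top_lt_card h).trans (𝒯.card_lt_top ξ)).le

theorem width_le (f : κ.ord.cof.ord.ToType → Ordinal.{u}) (ξ : κ.ord.cof.ord.ToType) :
    𝒯.width f ξ ≤ (𝒯.top ξ).ord :=
  ord_le_ord.2 ((𝒯.top_inaccessible ξ).isSuccLimit.succ_lt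
    ((𝒯.top_inaccessible ξ).isStrongPrelimit (𝒯.len_lt_top ξ f))).le

/-- Stages from `ξ` on are invisible below the cardinal of the `ξ`-th label, and the lengths before
`ξ` are computed from the common part of `f` and `g`. -/
theorem mem_image_congr {f g : κ.ord.cof.ord.ToType → Ordinal.{u}} {ξ : κ.ord.cof.ord.ToType}
    (h : ∀ ζ < ξ, f ζ = g ζ) {θ : Ordinal.{u}} (hθ : θ < (𝒯.label ξ).card.ord) :
    θ.toZFSet ∈ 𝒯.image f ↔ θ.toZFSet ∈ 𝒯.image g := by
  have hlow : ∀ a b : κ.ord.cof.ord.ToType, a < ξ → ¬ b < ξ → a < b := fun a b ha hb =>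
    ha.trans_le (not_lt.1 hb)
  have hcut : cut (· < ξ) (𝒯.width f) = cut (· < ξ) (𝒯.width g) := cut_congr fun ζ hζ => by
    rw [width, width, 𝒯.len_congr ζ f g fun η hη => by rw [h η (hη.trans hζ)]]
  rw [image, image,
    toZFSet_mem_emb_cut (w := 𝒯.width f) hlow (fun b hb => 𝒯.card_le_card (not_lt.1 hb)) _ hθ,
    toZFSet_mem_emb_cut (w := 𝒯.width g) hlow (fun b hb => 𝒯.card_le_card (not_lt.1 hb)) _ hθ, hcut]

/-- By induction the lengths used before `ζ` agree. If the codes at `ζ` differed, the lengths there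
would separate the images of `y` below `top ζ`. -/
theorem min_eq_min_of_image {f g : κ.ord.cof.ord.ToType → Ordinal.{u}}
    {ξ : κ.ord.cof.ord.ToType}
    (h : ∀ θ < (𝒯.top ξ).ord, (θ.toZFSet ∈ 𝒯.image f ↔ θ.toZFSet ∈ 𝒯.image g))
    {ζ : κ.ord.cof.ord.ToType} (hζ : ζ ≤ ξ) : ∀ η < ζ,
      min (f η) (𝒯.label ζ).card.ord = min (g η) (𝒯.label ζ).card.ord := by
  induction ζ using (wellFounded_lt (α := κ.ord.cof.ord.ToType)).induction with
  | _ ζ ih =>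
    by_contra hcon
    obtain ⟨t, ht, htop⟩ := 𝒯.exists_bound ζ
    obtain ⟨θ, hθ, hne⟩ := exists_not_iff_emb (w := 𝒯.width f) (w' := 𝒯.width g) rfl rfl
      (fun η hη => by rw [width, width, 𝒯.len_congr η f g (ih η hη (hη.le.trans hζ))])
      (𝒯.top_inaccessible ζ) (𝒯.top_lt ζ) (𝒯.card_le_len ζ f) (𝒯.len_lt_top ζ f)
      (𝒯.card_le_len ζ g) (𝒯.len_lt_top ζ g) (fun η hη => (𝒯.top_lt_card hη).le)
      (fun η hη => (𝒯.card_lt_top η).le.trans (htop η hη))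
      (fun η hη => (𝒯.width_le f η).trans (ord_le_ord.2 (htop η hη))) ht (𝒯.mk_Iio_lt ζ)
      (𝒯.differ ζ f g hcon)
    exact hne (h θ (hθ.trans_le (ord_le_ord.2 (𝒯.top_le_top hζ))))

theorem exists_top_eq {f : κ.ord.cof.ord.ToType → Ordinal.{u}} (hf : ∀ ζ, f ζ < κ.ord)
    (ξ : κ.ord.cof.ord.ToType) : ∃ ξ', ∀ g : κ.ord.cof.ord.ToType → Ordinal.{u},
      (∀ θ < (𝒯.top ξ').ord, (θ.toZFSet ∈ 𝒯.image f ↔ θ.toZFSet ∈ 𝒯.image g)) →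
      ∀ ζ < ξ, f ζ = g ζ := by
  have hsup : (⨆ ζ : Iio ξ, f ζ) < κ.ord :=
    Ordinal.iSup_lt_of_lt_cof (mk_Iio_ord_lt ξ) fun ζ => hf ζ
  obtain ⟨ξ₁, hξ₁⟩ := 𝒯.cofinal _ (lt_ord.1 hsup)
  -- At this position the cardinal of the label exceeds all values of `f` before `ξ`, so truncation
  -- loses nothing.
  refine ⟨max ξ ξ₁, fun g h ζ hζ => ?_⟩
  have h1 := 𝒯.min_eq_min_of_image h le_rfl ζ (hζ.trans_le (le_max_left _ _))
  have h2 : f ζ < (𝒯.label (max ξ ξ₁)).card.ord :=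
    (Ordinal.le_iSup (fun ζ : Iio ξ => f ζ) ⟨ζ, hζ⟩).trans_lt
      ((lt_ord.2 hξ₁).trans_le (ord_le_ord.2 (𝒯.card_le_card (le_max_right _ _))))
  rw [min_eq_left h2.le] at h1
  rcases min_choice (g ζ) (𝒯.label (max ξ ξ₁)).card.ord with h3 | h3
  · rw [h1, h3]
  · exact absurd (h1.trans h3) h2.ne

theorem oemb_lt (hκ0 : ℵ₀ < κ) (hκ : IsStrongPrelimit κ)
    (f : κ.ord.cof.ord.ToType → Ordinal.{u}) {θ : Ordinal.{u}} (hθ : θ < κ.ord) :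
    oemb (ults 𝒯.label (𝒯.width f)) θ < κ.ord := by
  obtain ⟨ξ, hξ⟩ := 𝒯.cofinal _ (lt_ord.1 hθ)
  obtain ⟨t, ht, htop⟩ := 𝒯.exists_bound ξ
  have hE : #(Steps κ (cut (· < ξ) (𝒯.width f))) < (𝒯.label ξ).card :=
    (mk_steps_cut_le fun ζ hζ => (𝒯.width_le f ζ).trans (ord_le_ord.2 (htop ζ hζ))).trans_lt
      (mul_lt_of_lt (𝒯.label ξ).inaccessible.aleph0_lt.le (𝒯.mk_Iio_lt ξ) ht)
  rw [oemb_cut (P := (· < ξ)) (fun a b ha hb => ha.trans_le (not_lt.1 hb))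
    (fun b hb => 𝒯.card_le_card (not_lt.1 hb)) (lt_ord.2 hξ)]
  exact oemb_lt_of_isStrongLimit hκ hκ0 (hE.trans (𝒯.label ξ).lt)
    (Y := {x | rk x < t.ord}) (fun p => mem_of_superset (𝒯.label p.pos).large
      fun x (hx : rk x < _) => hx.trans_le
        (ord_le_ord.2 ((𝒯.card_lt_top _).le.trans (htop _ p.prop_pos))))
    ((mk_rk_lt t).trans_lt (ht.trans (𝒯.label ξ).lt)) hθ

/-- For singular κ, the ultrafilters are more than cof(κ)-complete, so one of cof(κ) many bounds
works almost everywhere. For regular κ, finitely many coordinates range over a set of size less than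
κ, which bounds the values outright. -/
theorem exists_eventually_le (hρ : κ.ord.cof < κ → κ.ord.cof ≤ ρ) (hκ0 : ℵ₀ < κ)
    {w : κ.ord.cof.ord.ToType → Ordinal.{u}}
    {h : (Steps κ w → κ.ord.ToType) → Ordinal.{u}} (hh : FinSupp h) (hκ : ∀ x, h x < κ.ord) :
    ∃ θ < κ.ord, ∀ᶠ x in iterFilter (ults 𝒯.label w), h x ≤ θ := by
  rcases (Ordinal.cof_ord_le κ).lt_or_eq with hcof | hcof
  · by_contra hcon
    have hc : CardinalInterFilter (iterFilter (ults 𝒯.label w)) (Order.succ ρ) :=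
      iterFilter_cardinalInter fun p =>
        (𝒯.label p.pos).complete_of_le (Order.succ_le_of_lt (𝒯.lt_card _))
    have h1 : ∀ᶠ x in iterFilter (ults 𝒯.label w), ∀ ξ : κ.ord.cof.ord.ToType,
        ¬ h x ≤ (𝒯.label ξ).card.ord := by
      refine (eventually_cardinal_forall (c := Order.succ ρ) ?_).2 fun ξ => ?_
      · rw [mk_ord_toType]
        exact Order.lt_succ_of_le (hρ hcof)
      · exact (hh.comp (· ≤ (𝒯.label ξ).card.ord)).eventually_not.2 fun h' =>
          hcon ⟨_, ord_lt_ord.2 (𝒯.label ξ).lt, h'⟩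
    obtain ⟨x, hx⟩ := h1.exists
    obtain ⟨ξ, hξ⟩ := 𝒯.cofinal _ (lt_ord.1 (hκ x))
    exact hx ξ (lt_ord.2 hξ).le
  · obtain ⟨s, hs⟩ := hh
    set t : Cardinal.{u} := s.sup fun p => (𝒯.label p.pos).card with ht
    have htκ : t < κ := (Finset.sup_lt_iff (aleph0_pos.trans hκ0)).2 fun p _ => (𝒯.label p.pos).lt
    obtain ⟨n, e, g, hg, hgh⟩ := exists_eq_of_large (U := ults 𝒯.label w) hs
      (Y := {x | rk x < t.ord}) fun p hp => mem_of_superset (𝒯.label p.pos).large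
        fun x (hx : rk x < _) => hx.trans_le
          (ord_le_ord.2 (Finset.le_sup (f := fun p : Steps κ w => (𝒯.label p.pos).card) hp))
    refine ⟨⨆ k, g k, Ordinal.iSup_lt_of_lt_cof ?_ fun k => ?_, ?_⟩
    · rw [hcof, mk_pi, prod_const]
      simp only [mk_fin, lift_natCast, lift_uzero]
      refine (power_le_power_right ((mk_rk_lt t).trans (le_max_left t ℵ₀))).trans_lt
        ((by exact_mod_cast power_nat_le (le_max_right t ℵ₀) :
          max t ℵ₀ ^ (n : Cardinal.{u}) ≤ max t ℵ₀).trans_lt (max_lt htκ hκ0))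
    · obtain ⟨x, hx⟩ := hg k
      exact hx ▸ hκ x
    · filter_upwards [hgh] with x hx
      obtain ⟨k, -, hk⟩ := hx
      exact hk ▸ Ordinal.le_iSup g k

theorem oemb_ord (hρ : κ.ord.cof < κ → κ.ord.cof ≤ ρ) (hκ0 : ℵ₀ < κ) (hκ : IsStrongPrelimit κ)
    (f : κ.ord.cof.ord.ToType → Ordinal.{u}) :
    oemb (ults 𝒯.label (𝒯.width f)) κ.ord = κ.ord := by
  refine le_antisymm (le_of_not_gt fun hlt => ?_) (le_oemb _)
  obtain ⟨g, hg, hg', -, he⟩ := exists_ocollapse_eq (.const κ.ord) hlt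
  have hgκ : ∀ x, g x < κ.ord := fun x =>
    (hg' x).elim id fun h => h ▸ (ord_pos.2 (aleph0_pos.trans hκ0))
  obtain ⟨θ, hθ, hgθ⟩ := 𝒯.exists_eventually_le hρ hκ0 hg hgκ
  have h1 : ocollapse (ults 𝒯.label (𝒯.width f)) g ≤ oemb (ults 𝒯.label (𝒯.width f)) θ := by
    refine le_of_not_gt fun hlt => ?_
    obtain ⟨x, hx, hx'⟩ := (((ocollapse_lt_iff (.const _) hg).1 hlt).and hgθ).exists
    exact hx.not_ge hx'
  exact (h1.trans_lt (𝒯.oemb_lt hκ0 hκ f hθ)).ne he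

theorem emb_eq_self (f : κ.ord.cof.ord.ToType → Ordinal.{u}) {p : ZFSet.{u}}
    (hp : #(PerfectSubset.transClosure p) ≤ lift.{u + 1} ρ) :
    emb (ults 𝒯.label (𝒯.width f)) p = p := by
  refine emb_eq_self_of_small (c := Order.succ ρ)
    (T := {x | #(PerfectSubset.transClosure x) ≤ lift.{u + 1} ρ})
    (fun q : Steps κ (𝒯.width f) =>
      (𝒯.label q.pos).complete_of_le (Order.succ_le_of_lt (𝒯.lt_card _)))
    (fun t ht s hs => ?_) (fun t ht => ?_) hp
  · have hsub : PerfectSubset.transClosure s ⊆ PerfectSubset.transClosure t :=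
      fun r hr => Relation.TransGen.tail hr hs
    exact (mk_le_mk_of_subset hsub).trans ht
  · refine ⟨Shrink t, fun a => ((equivShrink t).symm a).1, Order.lt_succ_of_le ?_, fun s hs => ?_⟩
    · change t.card ≤ ρ
      rw [← Cardinal.lift_le.{u + 1}, ← ZFSet.cardinalMk_coe_sort]
      have hsub : (t : Set ZFSet.{u}) ⊆ PerfectSubset.transClosure t :=
        fun s hs => Relation.TransGen.single hs
      exact (mk_le_mk_of_subset hsub).trans ht
    · exact ⟨equivShrink t ⟨s, hs⟩, by simp⟩

end Tower

/-! ### Perfect embeddings -/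

/-- The first condition gives continuity and the second one continuity of the inverse; the second
one, applied beyond each `i`, also gives injectivity. -/
theorem isPerfectEmbedding_of_forall {μ κ ν : Ordinal.{u}} (hμ : Order.IsSuccLimit μ)
    {ι : PerfectSubset.FunSpace μ κ → PerfectSubset.PowSpace ν}
    (h₁ : ∀ f, ∀ η < ν, ∃ ξ < μ, ∀ g, (∀ i : Iio μ, i.1 < ξ → f i = g i) →
      (ι f).1 ∩ η.toZFSet = (ι g).1 ∩ η.toZFSet)
    (h₂ : ∀ f, ∀ ξ < μ, ∃ η < ν, ∀ g, (ι f).1 ∩ η.toZFSet = (ι g).1 ∩ η.toZFSet →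
      ∀ i : Iio μ, i.1 < ξ → f i = g i) :
    PerfectSubset.IsPerfectEmbedding ι := by
  refine ⟨⟨le_antisymm ?_ ?_⟩, fun f g hfg => funext fun i => ?_⟩
  · refine continuous_iff_le_induced.1 (continuous_generateFrom_iff.2 ?_)
    rintro _ ⟨η, hη, a, -, rfl⟩
    refine isOpen_iff_forall_mem_open.2 fun f hf => ?_
    obtain ⟨ξ, hξ, h⟩ := h₁ f η hη
    refine ⟨PerfectSubset.FunSpace.cone hξ fun i => f ⟨i.1, lt_trans i.2 hξ⟩, fun g hg => ?_,
      TopologicalSpace.isOpen_generateFrom_of_mem ⟨ξ, hξ, _, rfl⟩, fun i => rfl⟩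
    have h' := h g fun i hi => (hg ⟨i.1, hi⟩).symm
    exact h'.symm.trans hf
  · refine le_generateFrom ?_
    rintro _ ⟨ξ, hξ, s, rfl⟩
    choose η hη h using fun f => h₂ f ξ hξ
    -- The bound `η` depends on `f` and not only on `s`, so the open set is a union over all `f` in
    -- the cone.
    refine isOpen_induced_iff.2 ⟨⋃ f ∈ PerfectSubset.FunSpace.cone hξ s,
      {z | z.1 ∩ (η f).toZFSet = (ι f).1 ∩ (η f).toZFSet}, isOpen_biUnion fun f _ =>
        TopologicalSpace.isOpen_generateFrom_of_mem
          ⟨η f, hη f, _, fun w hw => (ZFSet.mem_inter.1 hw).2, rfl⟩, ?_⟩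
    ext g
    simp only [mem_preimage, mem_iUnion]
    constructor
    · rintro ⟨f, hf, hg⟩ i
      rw [← hf i]
      exact (h f g (Eq.symm hg) ⟨i.1, lt_trans i.2 hξ⟩ i.2).symm
    · exact fun hg => ⟨g, hg, rfl⟩
  · obtain ⟨η, -, h⟩ := h₂ f (i.1 + 1) (hμ.add_one_lt i.2)
    exact h g (by rw [hfg]) i (Order.lt_add_one_iff.2 le_rfl)

theorem inter_toZFSet_eq_iff {y z : ZFSet.{u}} {η : Ordinal.{u}} :
    y ∩ η.toZFSet = z ∩ η.toZFSet ↔ ∀ θ < η, (θ.toZFSet ∈ y ↔ θ.toZFSet ∈ z) := by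
  constructor
  · intro h θ hθ
    have h1 : ∀ x : ZFSet.{u}, θ.toZFSet ∈ x ∩ η.toZFSet ↔ θ.toZFSet ∈ x := fun x => by
      rw [ZFSet.mem_inter, Ordinal.toZFSet_mem_toZFSet_iff]
      exact and_iff_left hθ
    rw [← h1 y, h, h1]
  · intro h
    ext w
    simp only [ZFSet.mem_inter]
    refine and_congr_left fun hw => ?_
    obtain ⟨θ, hθ, rfl⟩ := Ordinal.mem_toZFSet_iff.1 hw
    exact h θ hθ

theorem Tower.isPerfectEmbedding {κ : Cardinal.{u}} [Nonempty κ.ord.ToType] {y : ZFSet.{u}}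
    {ρ : Cardinal.{u}} (𝒯 : Tower κ y ρ) (hκ0 : ℵ₀ ≤ κ)
    {ι : PerfectSubset.FunSpace κ.ord.cof.ord κ.ord → PerfectSubset.PowSpace κ.ord}
    (hι : ∀ f, (ι f).1 = 𝒯.image fun ξ => (f ⟨rk ξ, rk_lt ξ⟩).1) :
    PerfectSubset.IsPerfectEmbedding ι := by
  have hlim : Order.IsSuccLimit κ.ord.cof.ord :=
    isSuccLimit_ord (Ordinal.aleph0_le_cof_iff.2 (Ordinal.one_lt_cof_iff.2 (isSuccLimit_ord hκ0)))
  refine isPerfectEmbedding_of_forall hlim (fun f η hη => ?_) fun f ξ hξ => ?_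
  · obtain ⟨ξ, hξ⟩ := 𝒯.cofinal _ (lt_ord.1 hη)
    refine ⟨rk ξ, rk_lt ξ, fun g hg => ?_⟩
    rw [inter_toZFSet_eq_iff, hι, hι]
    refine fun θ hθ => 𝒯.mem_image_congr (fun ζ hζ => ?_) (hθ.trans (lt_ord.2 hξ))
    rw [hg ⟨rk ζ, rk_lt ζ⟩ (rk_lt_rk.2 hζ)]
  · obtain ⟨ξ', h⟩ := 𝒯.exists_top_eq (f := fun ξ => (f ⟨rk ξ, rk_lt ξ⟩).1)
      (fun ζ => (f ⟨rk ζ, rk_lt ζ⟩).2) (elt ξ hξ)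
    refine ⟨_, ord_lt_ord.2 (𝒯.top_lt ξ'), fun g hg i hi => ?_⟩
    rw [inter_toZFSet_eq_iff, hι, hι] at hg
    obtain ⟨i, hiμ : i < κ.ord.cof.ord⟩ := i
    have h1 := h _ hg (elt i hiμ) (by rwa [← rk_lt_rk, rk_elt, rk_elt])
    simp only [rk_elt] at h1
    exact Subtype.ext h1

end IteratedUltrapower

open IteratedUltrapower in
theorem theorem1p1 (κ : Cardinal.{u}) (hκ : PerfectSubset.IsLimitOfMeasurables κ)
    (D : ZFSet.{u}) (hD : D ⊆ ZFSet.powerset κ.ord.toZFSet)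
    (hdef : PerfectSubset.Sigma1DefinableWith
      (PerfectSubset.H κ ∪ {κ.ord.toZFSet}) D)
    (hcard : κ < D.card) :
    ∃ ι : PerfectSubset.FunSpace κ.ord.cof.ord κ.ord → PerfectSubset.PowSpace κ.ord,
      PerfectSubset.IsPerfectEmbedding ι ∧ ∀ c, (ι c).1 ∈ D := by
  obtain ⟨hne, hlim⟩ := hκ
  have hinacc : ∀ ν < κ, ∃ δ, ν < δ ∧ δ < κ ∧ IsInaccessible δ := fun ν hν => by
    obtain ⟨δ, h1, h2, h3⟩ := hlim ν hν
    exact ⟨δ, h1, h2, isInaccessible_of_isMeasurableCardinal h3⟩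
  have hκ0 : ℵ₀ < κ := by
    obtain ⟨δ, -, h2, h3⟩ := hinacc 0 (pos_iff_ne_zero.2 hne)
    exact h3.aleph0_lt.trans h2
  have hκ2 : ∀ ν < κ, (2 : Cardinal.{u}) ^ ν < κ := fun ν hν => by
    obtain ⟨δ, h1, h2, h3⟩ := hinacc ν hν
    exact (h3.isStrongPrelimit h1).trans h2
  have : Nonempty κ.ord.ToType := mk_ne_zero_iff.1 (by rwa [mk_ord_toType])
  have hlab : ∀ i : κ.ord.ToType, ∃ ℓ : Label κ, (rk i).card < ℓ.card := fun i => by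
    obtain ⟨δ, h1, h2, h3⟩ := hlim _ (lt_ord.1 (rk_lt i))
    obtain ⟨ℓ, rfl⟩ := exists_label h3 h2
    exact ⟨ℓ, h1⟩
  choose ℓ hℓ using hlab
  obtain ⟨y, hyD, hy⟩ := exists_moves hκ0.le hκ2 ℓ hD hcard
  obtain ⟨n, φ, p, hφ, hp, hDφ⟩ := hdef
  have hbd : ∀ i, ∃ ρ < κ, p i = κ.ord.toZFSet ∨
      #(PerfectSubset.transClosure (p i)) ≤ lift.{u + 1} ρ := fun i => by
    rcases hp i with h | h
    · obtain ⟨ρ, hρκ, hρ⟩ := lt_lift_iff.1 h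
      exact ⟨ρ, hρκ, .inr hρ.ge⟩
    · exact ⟨0, pos_iff_ne_zero.2 hne, .inl h⟩
  choose r hrκ hr using hbd
  -- `ρ` bounds the sizes of the parameters other than κ, so that they are fixed, and also cof(κ) if
  -- κ is singular, so that κ is fixed.
  obtain ⟨ρ, hρκ, hρr, hρ⟩ : ∃ ρ < κ, (∀ i, r i ≤ ρ) ∧ (κ.ord.cof < κ → κ.ord.cof ≤ ρ) := by
    have h1 : Finset.univ.sup r < κ :=
      (Finset.sup_lt_iff (pos_iff_ne_zero.2 hne)).2 fun i _ => hrκ i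
    by_cases h : κ.ord.cof < κ
    · exact ⟨max (Finset.univ.sup r) κ.ord.cof, max_lt h1 h, fun i =>
        (Finset.le_sup (Finset.mem_univ i)).trans (le_max_left _ _), fun _ => le_max_right _ _⟩
    · exact ⟨_, h1, fun i => Finset.le_sup (Finset.mem_univ i), fun h' => absurd h' h⟩
  obtain ⟨𝒯⟩ := exists_tower hκ2 hinacc ℓ
    (fun ν hν => ⟨elt ν.ord (ord_lt_ord.2 hν), by simpa using hℓ (elt ν.ord (ord_lt_ord.2 hν))⟩)
    hy hρκ
  have hmem : ∀ f, 𝒯.image f ∈ D := fun f => by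
    have h1 := realize_emb_of_sigma1 (U := ults 𝒯.label (𝒯.width f)) hφ _ _ ((hDφ y).1 hyD)
    have h2 : (fun a => emb (ults 𝒯.label (𝒯.width f))
        ((Fin.cons y p : Fin (n + 1) → ZFSet.{u}) a)) =
        Fin.cons (𝒯.image f) p := by
      funext a
      refine Fin.cases rfl (fun i => ?_) a
      simp only [Fin.cons_succ]
      rcases hr i with h | h
      · rw [h, emb_toZFSet, 𝒯.oemb_ord hρ hκ0 hκ2]
      · exact 𝒯.emb_eq_self f (h.trans (lift_le.2 (hρr i)))
    rw [h2] at h1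
    refine (hDφ _).2 ?_
    rw [FirstOrder.Language.Formula.Realize]
    convert h1
  exact ⟨fun f => ⟨𝒯.image fun ξ => (f ⟨rk ξ, rk_lt ξ⟩).1, ZFSet.mem_powerset.1 (hD (hmem _))⟩,
    𝒯.isPerfectEmbedding hκ0.le fun _ => rfl, fun _ => hmem _⟩
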